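/- Let $G$ be a finite simple connected graph whose vertex set $V$ is linearly ordered, with adjacency matrix $A(G)$, let $q\in\mathbb R^{V}$, and let $H(G)=-A(G)+\mathrm{diag}(q)$ be the associated discrete Schrödinger operator, with eigenvalues $\lambda_1\le\lambda_2\le\dots$ counted with multiplicity. Let $P$ be a bipartite $\nu$-partition of $G$: a spanning subgraph with $\nu$ connected components (domains) $P_1,\dots,P_\nu$ such that only edges running between different domains have been removed, and such that the graph whose vertices are the domains and whose edges are the removed edges is bipartite. Let $\mathcal C=E(G)\setminus E(P)$ and $\phi=|\mathcal C|$, and suppose that $\eta=\phi-(\nu-1)>0$. For $\alpha=(\alpha_e)_{e\in\mathcal C}$ with all $\alpha_e\ne0$ put $H(P;\alpha)=H(G)+\sum_{e\in\mathcal C}B_e(\alpha_e)$, where for $e=(i,j)$, $i<j$, the matrix $B_e(a)$ has entries $-a$ at $(i,i)$, $-1/a$ at $(j,j)$, $1$ at $(i,j)$ and $(j,i)$, and $0$ elsewhere. Let $\lambda_1(P_k;\alpha)$ be the lowest eigenvalue of the block of $H(P;\alpha)$ on the vertices of $P_k$. Let $\mathcal Q(P)\subset\mathbb R^{\phi}$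 be the set of those $\alpha$ (with all $\alpha_e\neq 0$) for which $\lambda_1(P_1;\alpha)=\dots=\lambda_1(P_\nu;\alpha)$, and for $\alpha\in\mathcal Q(P)$ let $\Lambda(P;\alpha)$ be this common value. 1. Near each of its points, $\mathcal Q(P)$ is a smooth $\eta$-dimensional submanifold of $\mathbb R^{\phi}$. 2. Let $\alpha^c\in\mathbb R^{\phi}$ have only negative entries. Then $\alpha^c$ is a point of $\mathcal Q(P)$ and a critical point of $\Lambda(P;\cdot)$ on $\mathcal Q(P)$ if and only if there is an eigenvector $f$ of $H(G)$ without zero components, with eigenvalue $\Lambda(P;\alpha^c)$, whose nodal domains form the partition $P$ and for which $\alpha^c_e=f_j/f_i$ for all $e=(i,j)\in\mathcal C$, $i<j$. In particular, if $\Lambda(P;\alpha^c)$ is not a multiple eigenvalue of $H(G)$, then $\alpha^c$ is a critical point if and only if it comes in this way from a non-degenerate eigenvector (no zero components, simple eigenvalue). 3. If $\alpha^c$ is such a critical point and $\Lambda(P;\alpha^c)$ is a simple eigenvalue of $H(G)$, namely the $n$-th one, $\Lambda(P;\alpha^c)=\lambda_n$, with eigenvector $f^{(n)}$ having $\nu_n$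 nodal domains, then the Morse index of $\Lambda(P;\cdot)$ on $\mathcal Q(P)$ at $\alpha^c$ equals $n-\nu_n$. -/

import Mathlib

open scoped ContDiff

noncomputable section

namespace NodalMorse

/-! ### Slice charts, critical points and Morse index on a submanifold of a normed space -/

section Manifold

variable {E : Type*} [NormedAddCommGroup E] [NormedSpace ℝ E]

/-- A smooth slice chart for the set `S ⊆ E` around the point `x ∈ S`: a `C^∞` diffeomorphism from
an open neighbourhood of `x` in `E` onto an open subset of `ℝ^d × ℝ^m` which carries `S` to the
slice `ℝ^d × {0}`. -/
structure SliceChart (S : Set E) (d : ℕ) (x : E) where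
  /-- the codimension -/
  codim : ℕ
  /-- the chart -/
  chart : OpenPartialHomeomorph E ((Fin d → ℝ) × (Fin codim → ℝ))
  mem_set : x ∈ S
  mem_source : x ∈ chart.source
  smooth : ContDiffOn ℝ ∞ chart chart.source
  smooth_symm : ContDiffOn ℝ ∞ chart.symm chart.target
  mem_iff : ∀ y ∈ chart.source, y ∈ S ↔ (chart y).2 = 0

/-- The local coordinate of the base point. -/
def SliceChart.base {S : Set E} {d : ℕ} {x : E} (φ : SliceChart S d x) : Fin d → ℝ :=
  (φ.chart x).1

/-- The expression, in the local coordinates `ℝ^d` of the chart, of a function `f` on `S`. -/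
def SliceChart.localExpr {S : Set E} {d : ℕ} {x : E} (φ : SliceChart S d x) (f : E → ℝ) :
    (Fin d → ℝ) → ℝ :=
  fun t => f (φ.chart.symm (t, 0))

/-- In a neighbourhood of its point `x`, the set `S` is a smooth embedded submanifold of `E` of
dimension `d`. -/
def IsSmoothSubmanifoldAt (S : Set E) (d : ℕ) (x : E) : Prop :=
  Nonempty (SliceChart S d x)

/-- `x ∈ S` is a critical point of the restriction of `f` to the (near `x`) `d`-dimensional
submanifold `S`: in local coordinates, `f` is differentiable at `x` with derivative zero. -/
def IsCriticalPointOn (S : Set E) (d : ℕ) (f : E → ℝ) (x : E) : Prop :=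
  IsSmoothSubmanifoldAt S d x ∧
    ∀ φ : SliceChart S d x, HasFDerivAt (φ.localExpr f) (0 : (Fin d → ℝ) →L[ℝ] ℝ) φ.base

/-- The second derivative (Hessian form) of `F` at `t`. -/
def hessian {d : ℕ} (F : (Fin d → ℝ) → ℝ) (t u v : Fin d → ℝ) : ℝ :=
  fderiv ℝ (fderiv ℝ F) t u v

/-- The number `m` is the index of the bilinear form `B`: the largest dimension of a subspace on
which `B` is negative definite. -/
def IsIndex {d : ℕ} (B : (Fin d → ℝ) → (Fin d → ℝ) → ℝ) (m : ℕ) : Prop :=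
  IsGreatest {k : ℕ | ∃ W : Submodule ℝ (Fin d → ℝ),
    Module.finrank ℝ W = k ∧ ∀ w ∈ W, w ≠ 0 → B w w < 0} m

/-- `x` is a critical point of the restriction of `f` to the submanifold `S`, this restriction is
smooth near `x`, and its Hessian at `x` has index `m`. -/
def HasMorseIndexOn (S : Set E) (d : ℕ) (f : E → ℝ) (x : E) (m : ℕ) : Prop :=
  IsCriticalPointOn S d f x ∧
    ∀ φ : SliceChart S d x,
      ContDiffAt ℝ ∞ (φ.localExpr f) φ.base ∧ IsIndex (hessian (φ.localExpr f) φ.base) m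

end Manifold

/-! ### Spectra of real symmetric matrices -/

section Spectrum

variable {ι : Type*} [Fintype ι]

/-- The lowest (real) eigenvalue of a matrix. -/
def lowestEigenvalue (M : Matrix ι ι ℝ) : ℝ :=
  sInf {μ : ℝ | Module.End.HasEigenvalue M.mulVecLin μ}

/-- The eigenvalues of a symmetric matrix in non-decreasing order, repeated according to
multiplicity; the index `i : Fin N` stands for the `(i + 1)`-st eigenvalue. -/
def sortedEigenvalue [DecidableEq ι] {M : Matrix ι ι ℝ} (hM : M.IsHermitian)
    (i : Fin (Fintype.card ι)) : ℝ :=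
  hM.eigenvalues₀ i.rev

end Spectrum

/-! ### Partitions of a graph -/

section Graph

variable {V : Type*}

/-- The spanning subgraph `P` of `G` is a partition of `G`: only edges of `G` which run between
different connected components of `P` have been removed. Its domains are the connected components
of `P`. -/
structure IsPartition (G P : SimpleGraph V) : Prop where
  le : P ≤ G
  adj_of_reachable : ∀ i j, P.Reachable i j → G.Adj i j → P.Adj i j

/-- The number `ν` of domains. -/
def numDomains (P : SimpleGraph V) : ℕ := Nat.card P.ConnectedComponent

/-- The graph whose vertices are the domains of `P`, two of them being joined if some removed edge
runs between them (multiplicities of edges play no role for its being bipartite). -/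
def partitionGraph (G P : SimpleGraph V) : SimpleGraph P.ConnectedComponent where
  Adj a b := a ≠ b ∧ ∃ i j, G.Adj i j ∧ ¬ P.Adj i j ∧
    P.connectedComponentMk i = a ∧ P.connectedComponentMk j = b
  symm := ⟨fun _ _ ⟨hne, i, j, hG, hP, hi, hj⟩ =>
    ⟨hne.symm, j, i, hG.symm, fun h => hP h.symm, hj, hi⟩⟩
  loopless := ⟨fun _ h => h.1 rfl⟩

/-- The graph obtained from `G` by keeping the edges between vertices on which `f` has the same
(strict) sign. If `f` vanishes nowhere, then this is the nodal partition of `G` induced by `f`: its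
connected components are the nodal domains of `f`. -/
def nodalGraph (G : SimpleGraph V) (f : V → ℝ) : SimpleGraph V where
  Adj i j := G.Adj i j ∧ 0 < f i * f j
  symm := ⟨fun i j h => ⟨h.1.symm, by rw [mul_comm]; exact h.2⟩⟩
  loopless := ⟨fun _ h => h.1.ne rfl⟩

/-- The number of nodal domains of a nowhere vanishing `f`. -/
def nodalCount (G : SimpleGraph V) (f : V → ℝ) : ℕ := numDomains (nodalGraph G f)

variable [LinearOrder V]

/-- The removed edges `e = (i, j)` of `G`, written with `i < j`. -/
abbrev CutEdge (G P : SimpleGraph V) : Type _ :=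
  {e : V × V // e.1 < e.2 ∧ G.Adj e.1 e.2 ∧ ¬ P.Adj e.1 e.2}

instance [Finite V] (G P : SimpleGraph V) : Fintype (CutEdge G P) := Fintype.ofFinite _

/-- The number `φ(G; P)` of removed edges. -/
def numCutEdges (G P : SimpleGraph V) : ℕ := Nat.card (CutEdge G P)

/-- The parameters `α_e = f_j / f_i`, `e = (i, j)`, `i < j`, induced by `f`. -/
def inducedParameters (G P : SimpleGraph V) (f : V → ℝ) : CutEdge G P → ℝ :=
  fun e => f e.1.2 / f e.1.1

end Graph

/-! ### Schrödinger operators and equipartitions -/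

section Hamiltonian

variable {V : Type*}

open Classical in
/-- The Schrödinger operator `H(G) = -A(G) + Q(G)` with on-site potential `q`. -/
def hamiltonian (G : SimpleGraph V) (q : V → ℝ) : Matrix V V ℝ :=
  -G.adjMatrix ℝ + Matrix.diagonal q

theorem hamiltonian_isHermitian (G : SimpleGraph V) (q : V → ℝ) :
    (hamiltonian G q).IsHermitian := by
  classical
  have h : (G.adjMatrix ℝ).IsHermitian := by
    ext i j
    simp [Matrix.conjTranspose_apply, SimpleGraph.adjMatrix_apply, G.adj_comm]
  have h2 : (Matrix.diagonal q).IsHermitian := Matrix.isHermitian_diagonal q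
  unfold hamiltonian
  convert h.neg.add h2

variable [Fintype V] [LinearOrder V]

/-- The perturbation `B(a)` accompanying the deletion of the edge `(i, j)`. -/
def edgePerturbation (i j : V) (a : ℝ) : Matrix V V ℝ :=
  Matrix.single i i (-a) + Matrix.single i j 1 + Matrix.single j i 1 + Matrix.single j j (-(1 / a))

/-- The parameter dependent Hamiltonian `H(P; α)`. -/
def partitionHamiltonian (G P : SimpleGraph V) (q : V → ℝ) (α : CutEdge G P → ℝ) :
    Matrix V V ℝ :=
  hamiltonian G q + ∑ e : CutEdge G P, edgePerturbation e.1.1 e.1.2 (α e)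

open Classical in
/-- `λ₁(P_k; α)`, the lowest eigenvalue of the block `H(P_k; α)` of `H(P; α)` on the domain `k`. -/
def domainEnergy (G P : SimpleGraph V) (q : V → ℝ) (α : CutEdge G P → ℝ)
    (k : P.ConnectedComponent) : ℝ :=
  lowestEigenvalue ((partitionHamiltonian G P q α).submatrix
    (Subtype.val : {v : V // P.connectedComponentMk v = k} → V) Subtype.val)

/-- The set `Q(P)` of parameters of equipartitions. -/
def equipartitionSet (G P : SimpleGraph V) (q : V → ℝ) : Set (CutEdge G P → ℝ) :=
  {α | (∀ e, α e ≠ 0) ∧ ∀ k l, domainEnergy G P q α k = domainEnergy G P q α l}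

/-- The equipartition energy `Λ(P; α)`: for `α ∈ Q(P)`, the common value of the `λ₁(P_k; α)` (the
value for other `α` is irrelevant). -/
def equipartitionEnergy (G P : SimpleGraph V) (q : V → ℝ) (α : CutEdge G P → ℝ) : ℝ :=
  ⨅ k : P.ConnectedComponent, domainEnergy G P q α k

theorem equipartitionEnergy_eq (G P : SimpleGraph V) (q : V → ℝ) {α : CutEdge G P → ℝ}
    (hα : α ∈ equipartitionSet G P q) (k : P.ConnectedComponent) :
    equipartitionEnergy G P q α = domainEnergy G P q α k := by
  have : Nonempty P.ConnectedComponent := ⟨k⟩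
  have h : (fun l => domainEnergy G P q α l) = fun _ => domainEnergy G P q α k :=
    funext fun l => hα.2 l k
  unfold equipartitionEnergy
  rw [h]
  exact ciInf_const

/-- The eigenspace of `H(G)` for `μ`. -/
abbrev eigenspaceOf (G : SimpleGraph V) (q : V → ℝ) (μ : ℝ) : Submodule ℝ (V → ℝ) :=
  Module.End.eigenspace (hamiltonian G q).mulVecLin μ

/-- `f` is an eigenvector of `H(G)` for the eigenvalue `μ` without vanishing components. -/
def IsNowhereZeroEigenvector (G : SimpleGraph V) (q : V → ℝ) (μ : ℝ) (f : V → ℝ) : Prop :=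
  Module.End.HasEigenvector (hamiltonian G q).mulVecLin μ f ∧ ∀ v, f v ≠ 0

/-- `f` is a non-degenerate eigenvector of `H(G)` for `μ`: it has no vanishing components and the
eigenvalue is simple. -/
def IsNondegenerateEigenvector (G : SimpleGraph V) (q : V → ℝ) (μ : ℝ) (f : V → ℝ) : Prop :=
  IsNowhereZeroEigenvector G q μ f ∧ Module.finrank ℝ (eigenspaceOf G q μ) = 1

end Hamiltonian

end NodalMorse

end

/-! On a cut edge the off-diagonal entries of `H(G)` and of `B_e(α_e)` cancel, so `H(P; α)` is a
Schrödinger operator on `P` itself, with a potential depending on `α` (`partitionHamiltonian_eq`).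
Each domain has a ground state of one sign, simple by Picone's identity; the inverse function
theorem makes ground states and energies smooth in the potential.

By Hellmann–Feynman, a linear relation between the differentials of the domain energies forces
weights `c` with `c_k ψ_i² = c_l ψ_j² / α_e²` on every cut edge `e = (i, j)` from domain `k` to
domain `l` (`exists_multiplier`). As `G` is connected, all these weights have the same sign
(`sign_multiplier_eq`). Hence no nontrivial relation has coefficients of sum zero: the `ν - 1`
energy differences have independent differentials and `Q(P)` is cut out by a submersion. At a
critical point a nontrivial relation exists, the multipliers of Lagrange. Multiplying `ψ` on each
domain by `√|c|` and by the sign of a two-colouring of the domains gives a vector annihilated by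
every rank one matrix `B_e`, hence an eigenvector of `H(G)`. Conversely, for an eigenvector the edge
terms of the Hellmann–Feynman formula vanish.

For the index let `K = H(P; α) - Λ`, `N = H(G) - Λ`, `a = -α > 0`, and let `J` be the map `jump`;
then `K = N + Jᵀ a J`. Differentiating Hellmann–Feynman once more shows that, in rescaled tangent
coordinates `x`, the Hessian is a positive multiple of the Schur complement `a⁻¹ - J K⁻¹ Jᵀ`, and
the tangent vectors are exactly the `x` with `Jᵀ x` in the range of `K` (`hessian_localExpr`,
`exists_scaledTangent_eq`). Here `K ≥ 0` has a kernel of dimension `ν`, while `N` has `n - 1`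
negative eigenvalues and a one-dimensional kernel. Two dimension counts in the spirit of inertia
additivity, `exists_negative_subspace` and `finrank_negative_subspace_le`, bound the index by `n -
ν` from below and from above. -/

namespace NodalMorse

/-! ### Positive solutions of the Schrödinger equation on the domains -/

section GroundState

variable {V : Type*}

open Classical in
/-- The adjacency matrix of a graph as a real kernel. -/
noncomputable def adjWeight (P : SimpleGraph V) (v w : V) : ℝ := if P.Adj v w then 1 else 0

theorem adjWeight_comm (P : SimpleGraph V) (v w : V) : adjWeight P v w = adjWeight P w v := by
  unfold adjWeight
  rw [P.adj_comm]

theorem adjWeight_nonneg (P : SimpleGraph V) (v w : V) : 0 ≤ adjWeight P v w := by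
  unfold adjWeight; split_ifs <;> norm_num

theorem adjWeight_of_adj {P : SimpleGraph V} {v w : V} (h : P.Adj v w) : adjWeight P v w = 1 :=
  if_pos h

theorem adjWeight_of_not_adj {P : SimpleGraph V} {v w : V} (h : ¬ P.Adj v w) :
    adjWeight P v w = 0 :=
  if_neg h

theorem adjWeight_mul_congr (P : SimpleGraph V) {v w : V} {x y : ℝ} (h : P.Adj v w → x = y) :
    adjWeight P v w * x = adjWeight P v w * y := by
  by_cases hvw : P.Adj v w
  · rw [h hvw]
  · simp [adjWeight_of_not_adj hvw]

theorem connectedComponentMk_eq_of_adj {P : SimpleGraph V} {v w : V} (h : P.Adj v w) :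
    P.connectedComponentMk v = P.connectedComponentMk w :=
  SimpleGraph.ConnectedComponent.eq.2 h.reachable

/-- A function taking equal values at adjacent vertices is constant on connected components. -/
theorem eq_of_reachable {P : SimpleGraph V} {X : Type*} {g : V → X}
    (h : ∀ v w, P.Adj v w → g v = g w) {v w : V} (hvw : P.Reachable v w) : g v = g w := by
  obtain ⟨p⟩ := hvw
  induction p with
  | nil => rfl
  | cons hadj _ ih => exact (h _ _ hadj).trans ih

/-- A vertex of the domain `k`. -/
noncomputable def domainRep {P : SimpleGraph V} (k : P.ConnectedComponent) : V :=
  k.exists_rep.choose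

@[simp]
theorem connectedComponentMk_domainRep {P : SimpleGraph V} (k : P.ConnectedComponent) :
    P.connectedComponentMk (domainRep k) = k :=
  k.exists_rep.choose_spec

theorem hamiltonian_apply_of_ne (P : SimpleGraph V) (d : V → ℝ) {v w : V} (h : v ≠ w) :
    hamiltonian P d v w = -adjWeight P v w := by
  classical
  simp [hamiltonian, h, SimpleGraph.adjMatrix_apply, adjWeight]

theorem hamiltonian_apply_self (P : SimpleGraph V) (d : V → ℝ) (v : V) :
    hamiltonian P d v v = d v := by
  classical
  simp [hamiltonian, SimpleGraph.adjMatrix_apply]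

variable [Fintype V]

theorem hamiltonian_mulVec_apply (P : SimpleGraph V) (d u : V → ℝ) (v : V) :
    (hamiltonian P d).mulVec u v = d v * u v - ∑ w, adjWeight P v w * u w := by
  classical
  unfold hamiltonian
  have h : ∀ i, (Matrix.diagonal d).mulVec u i = d i * u i := fun i =>
    Matrix.mulVec_diagonal d u i
  rw [Matrix.add_mulVec, Matrix.neg_mulVec, Pi.add_apply, Pi.neg_apply]
  have h2 : ((SimpleGraph.adjMatrix ℝ P).mulVec u) v = ∑ w, adjWeight P v w * u w := by
    simp [Matrix.mulVec, dotProduct, SimpleGraph.adjMatrix_apply, adjWeight]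
  rw [h2]
  have h3 := h v
  rw [neg_add_eq_sub]
  convert congrArg (· - ∑ w, adjWeight P v w * u w) h3 using 1

/-- Symmetry of the operator, domain by domain. -/
theorem sum_weighted_hamiltonian_comm (P : SimpleGraph V) (d : V → ℝ)
    (c : P.ConnectedComponent → ℝ) (u w : V → ℝ) :
    ∑ v, c (P.connectedComponentMk v) * (w v * (hamiltonian P d).mulVec u v) =
      ∑ v, c (P.connectedComponentMk v) * (u v * (hamiltonian P d).mulVec w v) := by
  have key : ∑ v, ∑ x, adjWeight P v x * (c (P.connectedComponentMk v) * w v * u x) =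
      ∑ v, ∑ x, adjWeight P v x * (c (P.connectedComponentMk v) * u v * w x) := by
    rw [Finset.sum_comm]
    refine Finset.sum_congr rfl fun v _ => Finset.sum_congr rfl fun x _ => ?_
    rw [adjWeight_comm]
    refine adjWeight_mul_congr P fun h => ?_
    rw [connectedComponentMk_eq_of_adj h]; ring
  have expand : ∀ a b : V → ℝ,
      ∑ v, c (P.connectedComponentMk v) * (a v * (hamiltonian P d).mulVec b v) =
      ∑ v, c (P.connectedComponentMk v) * (d v * a v * b v) -
        ∑ v, ∑ x, adjWeight P v x * (c (P.connectedComponentMk v) * a v * b x) := by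
    intro a b
    rw [← Finset.sum_sub_distrib]
    refine Finset.sum_congr rfl fun v _ => ?_
    rw [hamiltonian_mulVec_apply, mul_sub, mul_sub, Finset.mul_sum, Finset.mul_sum]
    congr 1
    · ring
    · exact Finset.sum_congr rfl fun x _ => by ring
  rw [expand, expand, key]
  congr 1
  exact Finset.sum_congr rfl fun v _ => by ring

theorem dotProduct_hamiltonian_comm (P : SimpleGraph V) (d u w : V → ℝ) :
    ∑ v, w v * (hamiltonian P d).mulVec u v = ∑ v, u v * (hamiltonian P d).mulVec w v := by
  simpa using sum_weighted_hamiltonian_comm P d (fun _ => 1) u w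

/-- `ψ` is nowhere zero, has no sign change along the edges of `P`, and on each domain `k` it
solves the eigenvalue equation of `-A(P) + diag(d)` for the energy `E k`. -/
structure IsGroundState (P : SimpleGraph V) (d : V → ℝ) (E : P.ConnectedComponent → ℝ)
    (ψ : V → ℝ) : Prop where
  ne_zero : ∀ v, ψ v ≠ 0
  pos_of_adj : ∀ v w, P.Adj v w → 0 < ψ v * ψ w
  eigen : ∀ v, (hamiltonian P d).mulVec ψ v = E (P.connectedComponentMk v) * ψ v

namespace IsGroundState

variable {P : SimpleGraph V} {d : V → ℝ} {E : P.ConnectedComponent → ℝ} {ψ : V → ℝ}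

/-- Picone's identity. -/
theorem picone (h : IsGroundState P d E ψ) (g : V → ℝ) :
    ∑ v, g v * ((hamiltonian P d).mulVec g v - E (P.connectedComponentMk v) * g v) =
      1 / 2 * ∑ v, ∑ w, adjWeight P v w * (ψ v * ψ w * (g v / ψ v - g w / ψ w) ^ 2) := by
  have h1 : ∀ v, g v * ((hamiltonian P d).mulVec g v - E (P.connectedComponentMk v) * g v) =
      ∑ w, adjWeight P v w * (g v ^ 2 * ψ w / ψ v - g v * g w) := by
    intro v
    have e := h.eigen v
    rw [hamiltonian_mulVec_apply] at e ⊢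
    have hv := h.ne_zero v
    have e' : d v - E (P.connectedComponentMk v) = (∑ w, adjWeight P v w * ψ w) / ψ v := by
      rw [eq_div_iff hv]; linarith
    have : ∑ w, adjWeight P v w * (g v ^ 2 * ψ w / ψ v - g v * g w) =
        g v ^ 2 * ((∑ w, adjWeight P v w * ψ w) / ψ v) - g v * ∑ w, adjWeight P v w * g w := by
      rw [Finset.sum_div, Finset.mul_sum, Finset.mul_sum, ← Finset.sum_sub_distrib]
      exact Finset.sum_congr rfl fun w _ => by ring
    rw [this, ← e']; ring
  -- Exchanging the two vertices; the sum of both forms completes the square, which explains the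
  -- factor `1 / 2`.
  have h2 : ∑ v, ∑ w, adjWeight P v w * (g v ^ 2 * ψ w / ψ v - g v * g w) =
      ∑ v, ∑ w, adjWeight P v w * (g w ^ 2 * ψ v / ψ w - g v * g w) := by
    rw [Finset.sum_comm]
    refine Finset.sum_congr rfl fun v _ => Finset.sum_congr rfl fun w _ => ?_
    rw [adjWeight_comm]; ring
  have h3 : ∑ v, ∑ w, adjWeight P v w * (ψ v * ψ w * (g v / ψ v - g w / ψ w) ^ 2) =
      ∑ v, ∑ w, adjWeight P v w * (g v ^ 2 * ψ w / ψ v - g v * g w) +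
      ∑ v, ∑ w, adjWeight P v w * (g w ^ 2 * ψ v / ψ w - g v * g w) := by
    rw [← Finset.sum_add_distrib]
    refine Finset.sum_congr rfl fun v _ => ?_
    rw [← Finset.sum_add_distrib]
    refine Finset.sum_congr rfl fun w _ => ?_
    have hv := h.ne_zero v
    have hw := h.ne_zero w
    field_simp
    ring
  rw [Finset.sum_congr rfl fun v _ => h1 v, h3, ← h2]
  ring

/-- Every term on the right of Picone's identity is nonnegative, since `ψ` does not change sign
along edges. This is what places each `E k` at the bottom of its block. -/
theorem quadratic_nonneg (h : IsGroundState P d E ψ) (g : V → ℝ) :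
    0 ≤ ∑ v, g v * ((hamiltonian P d).mulVec g v - E (P.connectedComponentMk v) * g v) := by
  rw [h.picone]
  refine mul_nonneg (by norm_num) (Finset.sum_nonneg fun v _ => Finset.sum_nonneg fun w _ => ?_)
  by_cases hvw : P.Adj v w
  · exact mul_nonneg (adjWeight_nonneg _ _ _)
      (mul_nonneg (h.pos_of_adj v w hvw).le (sq_nonneg _))
  · simp [adjWeight_of_not_adj hvw]

/-- The energy on each domain is nondegenerate. -/
theorem exists_eq_mul (h : IsGroundState P d E ψ) {g : V → ℝ}
    (hg : ∀ v, (hamiltonian P d).mulVec g v = E (P.connectedComponentMk v) * g v) :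
    ∃ c : P.ConnectedComponent → ℝ, ∀ v, g v = c (P.connectedComponentMk v) * ψ v := by
  have h0 : ∑ v, g v * ((hamiltonian P d).mulVec g v - E (P.connectedComponentMk v) * g v) = 0 :=
    Finset.sum_eq_zero fun v _ => by rw [hg]; ring
  rw [h.picone] at h0
  have nn : ∀ v w, 0 ≤ adjWeight P v w * (ψ v * ψ w * (g v / ψ v - g w / ψ w) ^ 2) := by
    intro v w
    by_cases hvw : P.Adj v w
    · exact mul_nonneg (adjWeight_nonneg _ _ _)
        (mul_nonneg (h.pos_of_adj v w hvw).le (sq_nonneg _))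
    · simp [adjWeight_of_not_adj hvw]
  have h1 : ∑ v, ∑ w, adjWeight P v w * (ψ v * ψ w * (g v / ψ v - g w / ψ w) ^ 2) = 0 := by
    linarith
  have h2 : ∀ v w, P.Adj v w → g v / ψ v = g w / ψ w := by
    intro v w hvw
    have a := (Finset.sum_eq_zero_iff_of_nonneg
      (fun v _ => Finset.sum_nonneg fun w _ => nn v w)).1 h1 v (Finset.mem_univ _)
    have b := (Finset.sum_eq_zero_iff_of_nonneg (fun w _ => nn v w)).1 a w (Finset.mem_univ _)
    rw [adjWeight_of_adj hvw, one_mul] at b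
    have := (mul_eq_zero.1 b).resolve_left (h.pos_of_adj v w hvw).ne'
    have := pow_eq_zero_iff (two_ne_zero) |>.1 this
    linarith
  refine ⟨fun k => g (domainRep k) / ψ (domainRep k), fun v => ?_⟩
  have hr : P.Reachable (domainRep (P.connectedComponentMk v)) v :=
    SimpleGraph.ConnectedComponent.exact (connectedComponentMk_domainRep _)
  have := eq_of_reachable h2 hr
  beta_reduce
  rw [this, div_mul_cancel₀ _ (h.ne_zero v)]

/-- Rescaling on each domain. -/
theorem rescale (h : IsGroundState P d E ψ) {c : P.ConnectedComponent → ℝ} (hc : ∀ k, c k ≠ 0) :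
    IsGroundState P d E (fun v => c (P.connectedComponentMk v) * ψ v) where
  ne_zero v := mul_ne_zero (hc _) (h.ne_zero v)
  pos_of_adj v w hvw := by
    rw [← connectedComponentMk_eq_of_adj hvw]
    have := mul_pos (h.pos_of_adj v w hvw) (pow_pos (abs_pos.2 (hc (P.connectedComponentMk v))) 2)
    rw [sq_abs] at this
    linarith
  eigen v := by
    rw [hamiltonian_mulVec_apply]
    have e := h.eigen v
    rw [hamiltonian_mulVec_apply] at e
    have : ∑ w, adjWeight P v w * (c (P.connectedComponentMk w) * ψ w) =
        c (P.connectedComponentMk v) * ∑ w, adjWeight P v w * ψ w := by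
      rw [Finset.mul_sum]
      refine Finset.sum_congr rfl fun w _ => ?_
      rw [mul_left_comm]
      by_cases hvw : P.Adj v w
      · rw [connectedComponentMk_eq_of_adj hvw]
      · simp [adjWeight_of_not_adj hvw]
    rw [this]
    linear_combination c (P.connectedComponentMk v) * e

theorem sum_weighted_pos (h : IsGroundState P d E ψ) (k : P.ConnectedComponent)
    {c : P.ConnectedComponent → ℝ} (hc : ∀ l, 0 ≤ c l) (hk : 0 < c k) :
    0 < ∑ v, c (P.connectedComponentMk v) * ψ v ^ 2 := by
  refine Finset.sum_pos' (fun v _ => mul_nonneg (hc _) (sq_nonneg _))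
    ⟨domainRep k, Finset.mem_univ _, ?_⟩
  rw [connectedComponentMk_domainRep]
  exact mul_pos hk (pow_pos (abs_pos.2 (h.ne_zero _)) 2 |>.trans_eq (sq_abs _))

end IsGroundState

open Classical in
/-- The lowest eigenvalue of the block of `-A(P) + diag(d)` on the domain `k`. -/
noncomputable def energy (P : SimpleGraph V) (d : V → ℝ) (k : P.ConnectedComponent) : ℝ :=
  lowestEigenvalue ((hamiltonian P d).submatrix
    (Subtype.val : {v : V // P.connectedComponentMk v = k} → V) Subtype.val)

/-- No edge of `P` leaves a domain, so the matrix entries lost by passing to the block are zero. -/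
theorem submatrix_mulVec_apply (P : SimpleGraph V) (d u : V → ℝ) (k : P.ConnectedComponent)
    [Fintype {v : V // P.connectedComponentMk v = k}]
    (i : {v : V // P.connectedComponentMk v = k}) :
    ((hamiltonian P d).submatrix
      (Subtype.val : {v : V // P.connectedComponentMk v = k} → V) Subtype.val).mulVec
        (fun j : {v : V // P.connectedComponentMk v = k} => u j.1) i = (hamiltonian P d).mulVec u i.1 := by
  simp only [Matrix.mulVec, dotProduct, Matrix.submatrix_apply]
  refine Fintype.sum_of_injective
    (Subtype.val : {v : V // P.connectedComponentMk v = k} → V) Subtype.val_injective _ _ (fun w hw => ?_)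
    fun _ => rfl
  have hw' : P.connectedComponentMk w ≠ k := fun h => hw ⟨⟨w, h⟩, rfl⟩
  have hne : i.1 ≠ w := by rintro rfl; exact hw' i.2
  have hadj : ¬ P.Adj i.1 w := fun h =>
    hw' ((connectedComponentMk_eq_of_adj h).symm.trans i.2)
  rw [hamiltonian_apply_of_ne _ _ hne, adjWeight_of_not_adj hadj]
  simp

/-- The restriction of `ψ` is an eigenvector of the block, and Picone's identity shows that no
eigenvalue lies below `E k`. -/
theorem IsGroundState.energy_eq {P : SimpleGraph V} {d : V → ℝ} {E : P.ConnectedComponent → ℝ}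
    {ψ : V → ℝ} (h : IsGroundState P d E ψ) (k : P.ConnectedComponent) : energy P d k = E k := by
  classical
  unfold energy lowestEigenvalue
  refine IsLeast.csInf_eq ⟨?_, ?_⟩
  · refine Module.End.hasEigenvalue_of_hasEigenvector (x := fun j => ψ j.1)
      (Module.End.hasEigenvector_iff.2 ⟨Module.End.mem_eigenspace_iff.2 ?_, ?_⟩)
    · ext i
      rw [Matrix.mulVecLin_apply, submatrix_mulVec_apply, h.eigen, i.2]
      rfl
    · intro h0
      have := congrFun h0 ⟨domainRep k, connectedComponentMk_domainRep k⟩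
      exact h.ne_zero _ this
  · rintro μ hμ
    obtain ⟨g, hg⟩ := hμ.exists_hasEigenvector
    obtain ⟨hg1, hg0⟩ := Module.End.hasEigenvector_iff.1 hg
    rw [Module.End.mem_eigenspace_iff] at hg1
    -- Extension by zero turns a block eigenvector into a test function on all of `V`.
    set u : V → ℝ := fun v => if hv : P.connectedComponentMk v = k then g ⟨v, hv⟩ else 0 with hu
    have hug : (fun j : {v : V // P.connectedComponentMk v = k} => u j.1) = g := by
      ext j; simp [hu, j.2]
    have hq := h.quadratic_nonneg u
    have : ∀ v, u v * ((hamiltonian P d).mulVec u v - E (P.connectedComponentMk v) * u v) =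
        (μ - E k) * u v ^ 2 := by
      intro v
      by_cases hv : P.connectedComponentMk v = k
      · have e := congrFun hg1 ⟨v, hv⟩
        rw [Matrix.mulVecLin_apply, ← hug, submatrix_mulVec_apply] at e
        have e' : (hamiltonian P d).mulVec u v = μ * u v := e
        rw [e', hv]; ring
      · simp [hu, hv]
    rw [Finset.sum_congr rfl fun v _ => this v, ← Finset.mul_sum] at hq
    obtain ⟨j, hj⟩ := Function.ne_iff.1 hg0
    have hpos : 0 < ∑ v, u v ^ 2 := by
      refine Finset.sum_pos' (fun v _ => sq_nonneg _) ⟨j.1, Finset.mem_univ _, ?_⟩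
      have : u j.1 = g j := congrFun hug j
      rw [this]
      exact (sq_pos_iff).2 hj
    nlinarith [nonneg_of_mul_nonneg_left hq hpos]

end GroundState
end NodalMorse

namespace NodalMorse

/-! ### Existence of ground states and their smooth dependence on the potential -/

section Existence

open Topology

variable {V : Type*} [Fintype V]

/-- Perron–Frobenius on one domain. -/
theorem exists_pos_eigenvector_on (P : SimpleGraph V) (d : V → ℝ) (k : P.ConnectedComponent) :
    ∃ (μ : ℝ) (g : V → ℝ), (∀ v, P.connectedComponentMk v = k → 0 < g v) ∧
      ∀ v, P.connectedComponentMk v = k → (hamiltonian P d).mulVec g v = μ * g v := by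
  classical
  set M := hamiltonian P d with hM
  set R : (V → ℝ) → ℝ := fun g => ∑ v, g v * M.mulVec g v with hR
  set S : Set (V → ℝ) :=
    {g | (∀ v, P.connectedComponentMk v ≠ k → g v = 0) ∧ ∑ v, g v ^ 2 = 1} with hS
  have hScl : IsClosed S := by
    rw [hS, Set.ofPred_and]
    refine IsClosed.inter ?_ (isClosed_eq (by fun_prop) continuous_const)
    simp only [Set.ofPred_forall]
    exact isClosed_iInter fun v => isClosed_iInter fun _ =>
      isClosed_eq (continuous_apply v) continuous_const
  have hScpt : IsCompact S := by
    refine (isCompact_closedBall (0 : V → ℝ) 1).of_isClosed_subset hScl fun g hg => ?_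
    rw [mem_closedBall_zero_iff, pi_norm_le_iff_of_nonneg zero_le_one]
    intro v
    have : g v ^ 2 ≤ 1 := hg.2 ▸
      Finset.single_le_sum (f := fun v => g v ^ 2) (fun _ _ => sq_nonneg _) (Finset.mem_univ v)
    rw [Real.norm_eq_abs]
    exact abs_le_one_iff_mul_self_le_one.2 (by nlinarith)
  have hSne : S.Nonempty := by
    refine ⟨Pi.single (domainRep k) 1, fun v hv => ?_, ?_⟩
    · refine Pi.single_eq_of_ne ?_ _
      rintro rfl
      exact hv (connectedComponentMk_domainRep k)
    · simp [Pi.single_apply]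
  have hRc : Continuous R := by
    refine continuous_finsetSum _ fun v _ => (continuous_apply v).mul ?_
    simp only [hM, hamiltonian_mulVec_apply]
    fun_prop
  obtain ⟨g, hgS, hgmin⟩ := hScpt.exists_isMinOn hSne hRc.continuousOn
  -- Off-diagonal entries are nonpositive, so replacing a minimizer of the Rayleigh quotient by its
  -- absolute value does not raise the energy.
  set h : V → ℝ := fun v => |g v| with hh
  have hhS : h ∈ S := ⟨fun v hv => by simp [hh, hgS.1 v hv], by simpa [hh] using hgS.2⟩
  have hle : R h ≤ R g := by
    refine Finset.sum_le_sum fun v _ => ?_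
    rw [hM, hamiltonian_mulVec_apply, hamiltonian_mulVec_apply, mul_sub, mul_sub,
      Finset.mul_sum, Finset.mul_sum]
    have e1 : h v * (d v * h v) = g v * (d v * g v) := by
      have := abs_mul_abs_self (g v)
      simp only [hh]; linear_combination d v * this
    rw [e1]
    refine sub_le_sub_left (Finset.sum_le_sum fun w _ => ?_) _
    have : g v * g w ≤ h v * h w := by
      simp only [hh]; rw [← abs_mul]; exact le_abs_self _
    nlinarith [adjWeight_nonneg P v w]
  set μ := R h with hμ
  have hbound : ∀ u : V → ℝ, (∀ v, P.connectedComponentMk v ≠ k → u v = 0) →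
      μ * ∑ v, u v ^ 2 ≤ R u := by
    intro u hu
    by_cases h0 : ∑ v, u v ^ 2 = 0
    · have : u = 0 := by
        ext v
        have := (Finset.sum_eq_zero_iff_of_nonneg fun v _ => sq_nonneg (u v)).1 h0 v
          (Finset.mem_univ v)
        simpa using this
      simp [this, hR]
    · have hpos : 0 < ∑ v, u v ^ 2 :=
        lt_of_le_of_ne (Finset.sum_nonneg fun _ _ => sq_nonneg _) (Ne.symm h0)
      set r := Real.sqrt (∑ v, u v ^ 2) with hr
      have hr0 : 0 < r := Real.sqrt_pos.2 hpos
      have hr2 : r ^ 2 = ∑ v, u v ^ 2 := Real.sq_sqrt hpos.le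
      have hm : (r⁻¹ • u) ∈ S := by
        refine ⟨fun v hv => by simp [hu v hv], ?_⟩
        simp only [Pi.smul_apply, smul_eq_mul, mul_pow, ← Finset.mul_sum, ← hr2]
        field_simp
      have h1 : R g ≤ R (r⁻¹ • u) := hgmin hm
      have h2 : R (r⁻¹ • u) = (r ^ 2)⁻¹ * R u := by
        simp only [hR, Matrix.mulVec_smul, Pi.smul_apply, smul_eq_mul, Finset.mul_sum]
        exact Finset.sum_congr rfl fun v _ => by ring
      rw [h2] at h1
      have h3 := hle.trans h1
      rw [← hr2]
      rw [← div_eq_inv_mul, le_div_iff₀ (by positivity)] at h3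
      exact h3
  have heig : ∀ v, P.connectedComponentMk v = k → M.mulVec h v = μ * h v := by
    intro v hv
    set w : V → ℝ := Pi.single v 1 with hw
    have hws : ∀ x, P.connectedComponentMk x ≠ k → w x = 0 := by
      intro x hx
      refine Pi.single_eq_of_ne ?_ _
      rintro rfl
      exact hx hv
    have hsum : ∀ F : V → ℝ, ∑ x, w x * F x = F v := by
      intro F; simp [hw, Pi.single_apply]
    -- Minimality of `h` tested against a perturbation at the single vertex `v`; the linear
    -- coefficient must vanish.
    have hquad : ∀ t : ℝ, 0 ≤ t * (2 * (M.mulVec h v - μ * h v)) +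
        t ^ 2 * (R w - μ * ∑ x, w x ^ 2) := by
      intro t
      have hb := hbound (h + t • w) (fun x hx => by simp [hhS.1 x hx, hws x hx])
      have e1 : R (h + t • w) = μ + t * (2 * M.mulVec h v) + t ^ 2 * R w := by
        have : R (h + t • w) = ∑ x, h x * M.mulVec h x + t * (∑ x, h x * M.mulVec w x) +
            t * (∑ x, w x * M.mulVec h x) + t ^ 2 * ∑ x, w x * M.mulVec w x := by
          simp only [hR, Matrix.mulVec_add, Matrix.mulVec_smul, Pi.add_apply, Pi.smul_apply,
            smul_eq_mul, Finset.mul_sum, ← Finset.sum_add_distrib]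
          exact Finset.sum_congr rfl fun x _ => by ring
        rw [this, dotProduct_hamiltonian_comm P d w h, ← hM, hsum]
        simp only [hμ, hR]; ring
      have e2 : ∑ x, (h + t • w) x ^ 2 = 1 + t * (2 * h v) + t ^ 2 * ∑ x, w x ^ 2 := by
        have : ∑ x, (h + t • w) x ^ 2 =
            ∑ x, h x ^ 2 + (2 * t) * ∑ x, w x * h x + t ^ 2 * ∑ x, w x ^ 2 := by
          simp only [Pi.add_apply, Pi.smul_apply, smul_eq_mul, Finset.mul_sum,
            ← Finset.sum_add_distrib]
          exact Finset.sum_congr rfl fun x _ => by ring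
        rw [this, hhS.2, hsum]; ring
      rw [e1, e2] at hb
      linarith
    by_contra hne
    set a := 2 * (M.mulVec h v - μ * h v) with ha
    set b := R w - μ * ∑ x, w x ^ 2 with hb
    have ha0 : a ≠ 0 := by
      rw [ha]; exact mul_ne_zero two_ne_zero (sub_ne_zero.2 hne)
    have hb0 : 0 ≤ b := sub_nonneg.2 (hbound w hws)
    -- This `t` makes the quadratic strictly negative if `a ≠ 0`; the `+ 1` covers the case `b = 0`.
    have := hquad (-a / (b + 1))
    have e : -a / (b + 1) * a + (-a / (b + 1)) ^ 2 * b = -(a ^ 2 / (b + 1) ^ 2) := by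
      field_simp; ring
    rw [e] at this
    have : 0 < a ^ 2 / (b + 1) ^ 2 := by positivity
    linarith
  refine ⟨μ, h, fun v hv => ?_, heig⟩
  by_contra hnp
  have hv0 : h v = 0 := le_antisymm (not_lt.1 hnp) (abs_nonneg _)
  -- At a zero of `h` the equation says that the nonnegative neighbouring values sum to zero, so
  -- zeros spread along edges and would fill the domain.
  have hzero : ∀ x, P.connectedComponentMk x = k → h x = 0 → ∀ y, P.Adj x y → h y = 0 := by
    intro x hx hx0 y hxy
    have e := heig x hx
    rw [hM, hamiltonian_mulVec_apply, hx0] at e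
    have e' : ∑ w, adjWeight P x w * h w = 0 := by linarith
    have := (Finset.sum_eq_zero_iff_of_nonneg fun w _ =>
      mul_nonneg (adjWeight_nonneg P x w) (abs_nonneg (g w))).1 e' y (Finset.mem_univ y)
    simpa [adjWeight_of_adj hxy, hh] using this
  have hiff : ∀ x y, P.Adj x y → (P.connectedComponentMk x = k ∧ h x = 0) =
      (P.connectedComponentMk y = k ∧ h y = 0) := by
    intro x y hxy
    have hk := connectedComponentMk_eq_of_adj hxy
    refine propext ⟨fun hx => ⟨hk ▸ hx.1, hzero x hx.1 hx.2 y hxy⟩,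
      fun hy => ⟨hk ▸ hy.1, hzero y hy.1 hy.2 x hxy.symm⟩⟩
  have hall : ∀ x, h x = 0 := by
    intro x
    by_cases hx : P.connectedComponentMk x = k
    · have hr : P.Reachable v x := SimpleGraph.ConnectedComponent.exact (hv.trans hx.symm)
      exact ((eq_of_reachable hiff hr).mp ⟨hv, hv0⟩).2
    · exact hhS.1 x hx
  have := hhS.2
  simp [hall] at this

/-- The equation at a vertex only involves its own domain, so the positive solutions on the separate
domains glue. -/
theorem exists_isGroundState (P : SimpleGraph V) (d : V → ℝ) :
    ∃ ψ : V → ℝ, IsGroundState P d (energy P d) ψ ∧ ∀ v, 0 < ψ v := by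
  choose μ g hpos heig using exists_pos_eigenvector_on P d
  have h : IsGroundState P d μ (fun v => g (P.connectedComponentMk v) v) :=
    { ne_zero := fun v => (hpos _ v rfl).ne'
      pos_of_adj := fun v w _ => mul_pos (hpos _ v rfl) (hpos _ w rfl)
      eigen := fun v => by
        have := heig _ v rfl
        rw [hamiltonian_mulVec_apply] at this ⊢
        rw [← this]
        congr 1
        exact Finset.sum_congr rfl fun w _ => adjWeight_mul_congr P fun hvw => by
          rw [connectedComponentMk_eq_of_adj hvw] }
  have hE : energy P d = μ := funext h.energy_eq
  exact ⟨_, hE ▸ h, fun v => hpos _ v rfl⟩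

noncomputable instance (P : SimpleGraph V) : Fintype P.ConnectedComponent := Fintype.ofFinite _

/-- Near `d`, the ground states can be chosen to depend smoothly on the potential, and so do the
energies of the domains. -/
theorem IsGroundState.exists_contDiffAt {P : SimpleGraph V} {d : V → ℝ}
    {E : P.ConnectedComponent → ℝ} {ψ : V → ℝ} (h : IsGroundState P d E ψ) :
    ∃ Ψ : (V → ℝ) → V → ℝ, ContDiffAt ℝ ∞ Ψ d ∧ Ψ d = ψ ∧ ContDiffAt ℝ ∞ (energy P) d ∧
      ∀ᶠ x in 𝓝 d, IsGroundState P x (energy P x) (Ψ x) := by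
  -- A nowhere zero `ψ` and the energies determine the potential: `d = E + (Aψ)/ψ`. Adding the
  -- values of `ψ` at one vertex per domain as a normalization makes the dimensions equal, so the
  -- inverse function theorem can recover `(E, ψ)` from `d`.
  set Θ : (P.ConnectedComponent → ℝ) × (V → ℝ) → (V → ℝ) × (P.ConnectedComponent → ℝ) := fun p =>
    (fun v => p.1 (P.connectedComponentMk v) + (∑ w, adjWeight P v w * p.2 w) / p.2 v,
      fun k => p.2 (domainRep k)) with hΘ
  set p₀ : (P.ConnectedComponent → ℝ) × (V → ℝ) := (E, ψ) with hp₀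
  have hsm : ContDiffAt ℝ ∞ Θ p₀ := by
    refine ContDiffAt.prodMk (contDiffAt_pi.2 fun v => ?_) (contDiffAt_pi.2 fun k => ?_)
    · refine ContDiffAt.add (by fun_prop) (ContDiffAt.div (by fun_prop) (by fun_prop) ?_)
      exact h.ne_zero v
    · fun_prop
  have hΘp : Θ p₀ = (d, fun k => ψ (domainRep k)) := by
    refine Prod.ext (funext fun v => ?_) rfl
    have e := h.eigen v
    rw [hamiltonian_mulVec_apply] at e
    have hv := h.ne_zero v
    simp only [hΘ, hp₀]
    field_simp
    linarith
  have hD := (hsm.differentiableAt (by simp)).hasFDerivAt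
  set D := fderiv ℝ Θ p₀
  have hinj : Function.Injective D := by
    rw [injective_iff_map_eq_zero]
    rintro ⟨μ, u⟩ h0
    have hline : HasDerivAt (fun s : ℝ => p₀ + s • (μ, u)) (μ, u) 0 := by
      simpa using ((hasDerivAt_id (0 : ℝ)).smul_const (μ, u)).const_add p₀
    have hcomp : HasDerivAt (fun s : ℝ => Θ (p₀ + s • (μ, u))) (D (μ, u)) 0 := by
      have := HasFDerivAt.comp_hasDerivAt (0 : ℝ) (l := Θ) (l' := D)
        (f := fun s : ℝ => p₀ + s • (μ, u)) (by simpa using hD) hline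
      exact this
    rw [h0] at hcomp
    have hM : ∀ v, (hamiltonian P d).mulVec u v =
        E (P.connectedComponentMk v) * u v + μ (P.connectedComponentMk v) * ψ v := by
      intro v
      have h1 := (hasDerivAt_pi.1 hcomp.fst) v
      have hu : ∀ w, HasDerivAt (fun s : ℝ => ψ w + s * u w) (u w) 0 := fun w => by
        simpa using ((hasDerivAt_id (0 : ℝ)).mul_const (u w)).const_add (ψ w)
      have h2 : HasDerivAt (fun s : ℝ => (E (P.connectedComponentMk v) +
          s * μ (P.connectedComponentMk v)) +
          (∑ w, adjWeight P v w * (ψ w + s * u w)) / (ψ v + s * u v))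
          (μ (P.connectedComponentMk v) +
          ((∑ w, adjWeight P v w * u w) * (ψ v + 0 * u v) -
            (∑ w, adjWeight P v w * (ψ w + 0 * u w)) * u v) / (ψ v + 0 * u v) ^ 2) 0 := by
        refine HasDerivAt.add ?_ (HasDerivAt.div
          (HasDerivAt.fun_sum fun w _ => (hu w).const_mul _) (hu v) (by simpa using h.ne_zero v))
        simpa using ((hasDerivAt_id (0 : ℝ)).mul_const
          (μ (P.connectedComponentMk v))).const_add (E (P.connectedComponentMk v))
      have h3 := h2.unique h1
      have hv := h.ne_zero v
      have e := h.eigen v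
      rw [hamiltonian_mulVec_apply] at e ⊢
      simp only [zero_mul, add_zero, Prod.fst_zero, Pi.zero_apply] at h3
      field_simp at h3
      have h4 : ψ v * (d v * u v - ∑ w, adjWeight P v w * u w -
        (E (P.connectedComponentMk v) * u v + μ (P.connectedComponentMk v) * ψ v)) = 0 := by
        linear_combination u v * e - h3
      linarith [(mul_eq_zero.1 h4).resolve_left hv]
    have hsymm := sum_weighted_hamiltonian_comm P d μ u ψ
    -- Symmetry of the operator, weighted on each domain by the unknown `μ` itself, leaves a sum of
    -- squares.
    have h5 : ∑ v, (μ (P.connectedComponentMk v) * ψ v) ^ 2 = 0 := by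
      rw [← sub_eq_zero, ← Finset.sum_sub_distrib] at hsymm
      rw [← hsymm]
      refine Finset.sum_congr rfl fun v _ => ?_
      rw [hM, h.eigen]; ring
    have hμ : μ = 0 := by
      ext k
      have := (Finset.sum_eq_zero_iff_of_nonneg fun v _ => sq_nonneg _).1 h5 (domainRep k)
        (Finset.mem_univ _)
      have := (mul_eq_zero.1 (pow_eq_zero_iff two_ne_zero |>.1 this)).resolve_right
        (h.ne_zero _)
      simpa using this
    obtain ⟨c, hc⟩ := h.exists_eq_mul (g := u) fun v => by rw [hM, hμ]; simp
    have hrep : ∀ k : P.ConnectedComponent, u (domainRep k) = 0 := by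
      intro k
      have h1 := (hasDerivAt_pi.1 hcomp.snd) k
      have h2 : HasDerivAt (fun s : ℝ => ψ (domainRep k) + s * u (domainRep k))
          (u (domainRep k)) 0 := by
        simpa using ((hasDerivAt_id (0 : ℝ)).mul_const (u (domainRep k))).const_add
          (ψ (domainRep k))
      exact h2.unique h1
    have hu0 : u = 0 := by
      ext v
      have h1 := hrep (P.connectedComponentMk v)
      rw [hc, connectedComponentMk_domainRep] at h1
      rw [hc, (mul_eq_zero.1 h1).resolve_right (h.ne_zero _)]
      simp
    rw [hμ, hu0]; rfl
  have hdim : Module.finrank ℝ ((P.ConnectedComponent → ℝ) × (V → ℝ)) =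
      Module.finrank ℝ ((V → ℝ) × (P.ConnectedComponent → ℝ)) := by
    simp [add_comm]
  set e := (LinearMap.linearEquivOfInjective D.toLinearMap hinj hdim).toContinuousLinearEquiv
  have hD' : HasFDerivAt Θ (e : _ →L[ℝ] _) p₀ := by
    have : (e : _ →L[ℝ] _) = D := by ext x <;> rfl
    rw [this]; exact hD
  have hn : (∞ : WithTop ℕ∞) ≠ 0 := by simp
  set inv := hsm.localInverse hD' hn with hinv
  have hinvs : ContDiffAt ℝ ∞ inv (Θ p₀) := hsm.to_localInverse hD' hn
  have hinv0 : inv (Θ p₀) = p₀ := hsm.localInverse_apply_image hD' hn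
  have hright : ∀ᶠ y in 𝓝 (Θ p₀), Θ (inv y) = y :=
    (hsm.hasStrictFDerivAt' hD' hn).eventually_right_inverse
  -- The potential varies while the normalization stays at its value for `ψ`.
  set ι : (V → ℝ) → (V → ℝ) × (P.ConnectedComponent → ℝ) :=
    fun x => (x, fun k => ψ (domainRep k)) with hι
  have hιs : ContDiff ℝ ∞ ι := contDiff_id.prodMk contDiff_const
  have hιd : ι d = Θ p₀ := hΘp.symm
  have hcs : ContDiffAt ℝ ∞ (fun x => inv (ι x)) d :=
    ContDiffAt.comp d (hιd ▸ hinvs) hιs.contDiffAt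
  have hΨs : ContDiffAt ℝ ∞ (fun x => (inv (ι x)).2) d := hcs.snd
  have hLs : ContDiffAt ℝ ∞ (fun x => (inv (ι x)).1) d := hcs.fst
  have hev : ∀ᶠ x in 𝓝 d, IsGroundState P x (inv (ι x)).1 (inv (ι x)).2 := by
    have hψd : (inv (ι d)).2 = ψ := by rw [hιd, hinv0]
    have hcont : ∀ v, ContinuousAt (fun x => (inv (ι x)).2 v) d := fun v =>
      (continuous_apply v).continuousAt.comp hΨs.continuousAt
    have ev1 : ∀ᶠ x in 𝓝 d, ∀ v, (inv (ι x)).2 v ≠ 0 :=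
      Filter.eventually_all.2 fun v => (hcont v).eventually_ne (by rw [hψd]; exact h.ne_zero v)
    have ev2 : ∀ᶠ x in 𝓝 d, ∀ v w, P.Adj v w → 0 < (inv (ι x)).2 v * (inv (ι x)).2 w := by
      refine Filter.eventually_all.2 fun v => Filter.eventually_all.2 fun w => ?_
      by_cases hvw : P.Adj v w
      · have : ContinuousAt (fun x => (inv (ι x)).2 v * (inv (ι x)).2 w) d :=
          (hcont v).mul (hcont w)
        filter_upwards [this.eventually (lt_mem_nhds (a := 0)
          (by beta_reduce; rw [hψd]; exact h.pos_of_adj v w hvw))] with x hx _ using hx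
      · exact Filter.Eventually.of_forall fun x hx => absurd hx hvw
    have ev3 : ∀ᶠ x in 𝓝 d, Θ (inv (ι x)) = ι x :=
      hιs.continuous.continuousAt.eventually (hιd ▸ hright)
    filter_upwards [ev1, ev2, ev3] with x h1 h2 h3
    refine ⟨h1, h2, fun v => ?_⟩
    have := congrFun (congrArg Prod.fst h3) v
    simp only [hΘ, hι] at this
    have hv := h1 v
    rw [hamiltonian_mulVec_apply]
    simp only [hι] at hv ⊢
    rw [← this]
    field_simp
    ring
  have hE : ∀ᶠ x in 𝓝 d, energy P x = (inv (ι x)).1 := by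
    filter_upwards [hev] with x hx
    exact funext hx.energy_eq
  refine ⟨fun x => (inv (ι x)).2, hΨs, by beta_reduce; rw [hιd, hinv0],
    hLs.congr_of_eventuallyEq hE, ?_⟩
  filter_upwards [hev, hE] with x hx hx'
  rw [hx']; exact hx

theorem contDiff_energy (P : SimpleGraph V) : ContDiff ℝ ∞ (energy P) :=
  contDiff_iff_contDiffAt.2 fun d => by
    obtain ⟨ψ, hψ, -⟩ := exists_isGroundState P d
    obtain ⟨-, -, -, h, -⟩ := hψ.exists_contDiffAt
    exact h

end Existence
end NodalMorse

namespace NodalMorse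

/-! ### Zero sets of submersions and the parametrizations given by slice charts -/

section Submanifold

open Topology

variable {E : Type*} [NormedAddCommGroup E] [NormedSpace ℝ E]

/-- The zero set of a smooth submersion is a submanifold. -/
theorem isSmoothSubmanifoldAt_of_submersion {F : Type*} [NormedAddCommGroup F] [NormedSpace ℝ F]
    [FiniteDimensional ℝ E] [FiniteDimensional ℝ F] {U : Set E} (hU : IsOpen U) {g : E → F}
    (hg : ContDiffOn ℝ ∞ g U) {x : E} (hxU : x ∈ U) (hgx : g x = 0)
    (hsurj : Function.Surjective (fderiv ℝ g x)) {d : ℕ}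
    (hd : d + Module.finrank ℝ F = Module.finrank ℝ E) {S : Set E}
    (hS : ∀ y ∈ U, y ∈ S ↔ g y = 0) : IsSmoothSubmanifoldAt S d x := by
  have : CompleteSpace E := FiniteDimensional.complete ℝ E
  set D := fderiv ℝ g x with hD
  set m := Module.finrank ℝ F
  have hker : Module.finrank ℝ (LinearMap.ker D.toLinearMap) = d := by
    have h1 := LinearMap.finrank_range_add_finrank_ker D.toLinearMap
    rw [LinearMap.range_eq_top.2 hsurj, finrank_top] at h1
    omega
  -- A linear projection onto the kernel of the differential supplies the slice coordinates;
  -- together with `g` it has injective differential at `x`.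
  obtain ⟨π, hπ⟩ := LinearMap.exists_leftInverse_of_injective
    (LinearMap.ker D.toLinearMap).subtype (Submodule.ker_subtype _)
  set e1 : (LinearMap.ker D.toLinearMap) ≃ₗ[ℝ] (Fin d → ℝ) :=
    LinearEquiv.ofFinrankEq _ _ (by simp [hker])
  set e2 : F ≃L[ℝ] (Fin m → ℝ) :=
    (LinearEquiv.ofFinrankEq F (Fin m → ℝ) (by simp [m])).toContinuousLinearEquiv
  set p : E →L[ℝ] (Fin d → ℝ) := LinearMap.toContinuousLinearMap (e1.toLinearMap ∘ₗ π) with hp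
  set Θ : E → (Fin d → ℝ) × (Fin m → ℝ) := fun y => (p y, e2 (g y)) with hΘ
  have hΘs : ContDiffOn ℝ ∞ Θ U :=
    p.contDiff.contDiffOn.prodMk (e2.contDiff.comp_contDiffOn hg)
  have hΘx : ContDiffAt ℝ ∞ Θ x := hΘs.contDiffAt (hU.mem_nhds hxU)
  have hgd : HasFDerivAt g D x :=
    ((hg.contDiffAt (hU.mem_nhds hxU)).differentiableAt (by simp)).hasFDerivAt
  set T : E →L[ℝ] (Fin d → ℝ) × (Fin m → ℝ) := p.prod ((e2 : F →L[ℝ] (Fin m → ℝ)).comp D) with hT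
  have hΘD : HasFDerivAt Θ T x :=
    p.hasFDerivAt.prodMk ((e2 : F →L[ℝ] (Fin m → ℝ)).hasFDerivAt.comp x hgd)
  have hinj : Function.Injective T := by
    rw [injective_iff_map_eq_zero]
    intro y hy
    have h1 : p y = 0 := congrArg Prod.fst hy
    have h2 : e2 (D y) = 0 := congrArg Prod.snd hy
    have h3 : D y = 0 := by simpa using h2
    have h4 : π y = 0 := by simpa [hp] using h1
    have h5 := LinearMap.congr_fun hπ ⟨y, h3⟩
    simp only [LinearMap.comp_apply, Submodule.subtype_apply, LinearMap.id_apply, h4] at h5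
    exact (congrArg Subtype.val h5).symm
  have hdim : Module.finrank ℝ E = Module.finrank ℝ ((Fin d → ℝ) × (Fin m → ℝ)) := by
    simp [m, ← hd]
  set e := (LinearMap.linearEquivOfInjective T.toLinearMap hinj hdim).toContinuousLinearEquiv
  have he : (e : E →L[ℝ] _) = T := by ext y <;> rfl
  have hΘD' : HasFDerivAt Θ (e : E →L[ℝ] _) x := he ▸ hΘD
  have hn : (∞ : WithTop ℕ∞) ≠ 0 := by simp
  -- Restricting to points with invertible differential makes the inverse chart smooth on its whole
  -- target, not only at the image of `x`.
  set O : Set E := U ∩ fderiv ℝ Θ ⁻¹' 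
      Set.range (fun e' : E ≃L[ℝ] ((Fin d → ℝ) × (Fin m → ℝ)) => (e' : E →L[ℝ] _)) with hO
  have hOo : IsOpen O := (hΘs.continuousOn_fderiv_of_isOpen hU (by simp)).isOpen_inter_preimage hU
    ContinuousLinearEquiv.isOpen
  have hxO : x ∈ O := ⟨hxU, e, hΘD'.fderiv.symm⟩
  set χ := (hΘx.toOpenPartialHomeomorph Θ hΘD' hn).restrOpen O hOo with hχ
  have hcoe : (χ : E → _) = Θ := rfl
  have hsrc : χ.source ⊆ O := fun y hy => hy.2
  refine ⟨⟨m, χ, (hS x hxU).2 hgx, ⟨hΘx.mem_toOpenPartialHomeomorph_source hΘD' hn, hxO⟩,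
    hcoe ▸ hΘs.mono fun y hy => (hsrc hy).1, ?_, ?_⟩⟩
  · intro z hz
    obtain ⟨hzU, e', he'⟩ := hsrc (χ.map_target hz)
    have hat : ContDiffAt ℝ ∞ Θ (χ.symm z) := hΘs.contDiffAt (hU.mem_nhds hzU)
    refine (χ.contDiffAt_symm hz (f₀' := e') ?_ hat).contDiffWithinAt
    rw [show (e' : E →L[ℝ] _) = fderiv ℝ Θ (χ.symm z) from he']
    exact (hat.differentiableAt (by simp)).hasFDerivAt
  · intro y hy
    rw [hS y (hsrc hy).1, hcoe]
    simp [hΘ]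

namespace SliceChart

variable {S : Set E} {d : ℕ} {x : E} (φ : SliceChart S d x)

/-- The local parametrization of `S` given by a slice chart. -/
noncomputable def param (t : Fin d → ℝ) : E := φ.chart.symm (t, 0)

theorem chart_base : φ.chart x = (φ.base, 0) :=
  Prod.ext rfl ((φ.mem_iff x φ.mem_source).1 φ.mem_set)

@[simp]
theorem param_base : φ.param φ.base = x := by
  rw [param, ← chart_base]
  exact φ.chart.left_inv φ.mem_source

theorem eventually_mem_target : ∀ᶠ t in 𝓝 φ.base, (t, (0 : Fin φ.codim → ℝ)) ∈ φ.chart.target := by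
  have hc : ContinuousAt (fun t : Fin d → ℝ => (t, (0 : Fin φ.codim → ℝ))) φ.base := by fun_prop
  refine hc.eventually (φ.chart.open_target.mem_nhds ?_)
  beta_reduce
  rw [← chart_base]
  exact φ.chart.map_source φ.mem_source

theorem eventually_param_mem : ∀ᶠ t in 𝓝 φ.base, φ.param t ∈ S := by
  filter_upwards [φ.eventually_mem_target] with t ht
  have := φ.chart.map_target ht
  rw [param, φ.mem_iff _ this, φ.chart.right_inv ht]

theorem contDiffAt_param : ContDiffAt ℝ ∞ φ.param φ.base := by
  have h1 : ContDiffAt ℝ ∞ φ.chart.symm (φ.base, (0 : Fin φ.codim → ℝ)) :=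
    φ.smooth_symm.contDiffAt (φ.chart.open_target.mem_nhds φ.eventually_mem_target.self_of_nhds)
  exact ContDiffAt.comp φ.base (g := φ.chart.symm)
    (f := fun t : Fin d → ℝ => (t, (0 : Fin φ.codim → ℝ))) h1 (by fun_prop)

/-- Near the base point the chart composed with `param` is `t ↦ (t, 0)`, whose derivative is the
injection `inl`. -/
theorem injective_fderiv_param : Function.Injective (fderiv ℝ φ.param φ.base) := by
  have h1 : HasFDerivAt φ.param (fderiv ℝ φ.param φ.base) φ.base :=
    (φ.contDiffAt_param.differentiableAt (by simp)).hasFDerivAt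
  have h2 : HasFDerivAt φ.chart (fderiv ℝ φ.chart x) (φ.param φ.base) := by
    rw [param_base]
    exact ((φ.smooth.contDiffAt (φ.chart.open_source.mem_nhds φ.mem_source)).differentiableAt
      (by simp)).hasFDerivAt
  have h3 := h2.comp φ.base h1
  have h4 : HasFDerivAt (fun t : Fin d → ℝ => (t, (0 : Fin φ.codim → ℝ)))
      ((fderiv ℝ φ.chart x).comp (fderiv ℝ φ.param φ.base)) φ.base := by
    refine h3.congr_of_eventuallyEq ?_
    filter_upwards [φ.eventually_mem_target] with t ht
    exact (φ.chart.right_inv ht).symm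
  have h5 : HasFDerivAt (fun t : Fin d → ℝ => (t, (0 : Fin φ.codim → ℝ)))
      (ContinuousLinearMap.inl ℝ _ _) φ.base :=
    (ContinuousLinearMap.inl ℝ (Fin d → ℝ) (Fin φ.codim → ℝ)).hasFDerivAt
  have h6 := h4.unique h5
  rw [injective_iff_map_eq_zero]
  intro w hw
  have := DFunLike.congr_fun h6 w
  rw [ContinuousLinearMap.comp_apply, hw, map_zero] at this
  exact (congrArg Prod.fst this).symm

end SliceChart

end Submanifold
end NodalMorse

namespace NodalMorse

/-! ### The parameter dependent Hamiltonian as a Schrödinger operator on `P` -/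

section CutPotential

open Topology

theorem edgePerturbation_apply {V : Type*} [LinearOrder V] (i j v w : V) (a : ℝ) :
    edgePerturbation i j a v w = (if i = v ∧ i = w then -a else 0) +
      (if i = v ∧ j = w then 1 else 0) + (if j = v ∧ i = w then 1 else 0) +
      if j = v ∧ j = w then -a⁻¹ else 0 := by
  simp [edgePerturbation, Matrix.single_apply]

variable {V : Type*} [Fintype V] [LinearOrder V]

/-- The on-site potential of `H(P; α)`. -/
noncomputable def cutPotential (G P : SimpleGraph V) (q : V → ℝ) (α : CutEdge G P → ℝ) (v : V) :
    ℝ :=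
  q v - ∑ e : CutEdge G P, ((if e.1.1 = v then α e else 0) + if e.1.2 = v then (α e)⁻¹ else 0)

theorem sum_cutEdge_indicator (G P : SimpleGraph V) (v w : V) :
    ∑ e : CutEdge G P, (if e.1.1 = v ∧ e.1.2 = w then (1 : ℝ) else 0) =
      if v < w then adjWeight G v w * (1 - adjWeight P v w) else 0 := by
  by_cases h : v < w ∧ G.Adj v w ∧ ¬ P.Adj v w
  · rw [Finset.sum_eq_single ⟨(v, w), h⟩]
    · simp [h.1, adjWeight_of_adj h.2.1, adjWeight_of_not_adj h.2.2]
    · rintro e - he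
      refine if_neg fun hvw => he (Subtype.ext (Prod.ext hvw.1 hvw.2))
    · simp
  · rw [Finset.sum_eq_zero]
    · split_ifs with hlt
      · by_cases hG : G.Adj v w
        · have hP : P.Adj v w := by by_contra hP; exact h ⟨hlt, hG, hP⟩
          simp [adjWeight_of_adj hP]
        · simp [adjWeight_of_not_adj hG]
      · rfl
    · rintro e -
      refine if_neg ?_
      rintro ⟨rfl, rfl⟩
      exact h e.2

/-- The entries `1` of `B_e` at `(i, j)` and `(j, i)` cancel the `-1` of `-A(G)` on the cut edge;
what remains of `B_e` is diagonal. -/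
theorem partitionHamiltonian_eq {G P : SimpleGraph V} (hle : P ≤ G) (q : V → ℝ)
    (α : CutEdge G P → ℝ) :
    partitionHamiltonian G P q α = hamiltonian P (cutPotential G P q α) := by
  ext v w
  rw [partitionHamiltonian, Matrix.add_apply, Matrix.sum_apply]
  simp only [edgePerturbation_apply]
  by_cases hvw : v = w
  · subst hvw
    rw [hamiltonian_apply_self, hamiltonian_apply_self, cutPotential, sub_eq_add_neg,
      ← Finset.sum_neg_distrib]
    congr 1
    refine Finset.sum_congr rfl fun e _ => ?_
    have hne : ¬ (e.1.1 = v ∧ e.1.2 = v) := fun h => e.2.1.ne (h.1.trans h.2.symm)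
    have hne' : ¬ (e.1.2 = v ∧ e.1.1 = v) := fun h => hne h.symm
    simp only [and_self, if_neg hne, if_neg hne', add_zero]
    split_ifs <;> simp [add_comm]
  · rw [hamiltonian_apply_of_ne _ _ hvw, hamiltonian_apply_of_ne _ _ hvw]
    have h1 : ∀ i : V, ¬ (i = v ∧ i = w) := fun i h => hvw (h.1.symm.trans h.2)
    simp only [h1, if_false, zero_add, add_zero, Finset.sum_add_distrib]
    have h2 : ∑ e : CutEdge G P, (if e.1.2 = v ∧ e.1.1 = w then (1 : ℝ) else 0) =
        if w < v then adjWeight G v w * (1 - adjWeight P v w) else 0 := by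
      rw [adjWeight_comm G, adjWeight_comm P, ← sum_cutEdge_indicator]
      exact Finset.sum_congr rfl fun e _ => by simp only [and_comm]
    rw [sum_cutEdge_indicator, h2]
    have h3 : adjWeight G v w * (1 - adjWeight P v w) = adjWeight G v w - adjWeight P v w := by
      by_cases hP : P.Adj v w
      · simp [adjWeight_of_adj hP, adjWeight_of_adj (hle hP)]
      · simp [adjWeight_of_not_adj hP]
    rw [h3]
    rcases lt_or_gt_of_ne hvw with h | h
    · rw [if_pos h, if_neg h.not_gt]; ring
    · rw [if_neg h.not_gt, if_pos h]; ring

theorem domainEnergy_eq {G P : SimpleGraph V} (hle : P ≤ G) (q : V → ℝ) (α : CutEdge G P → ℝ) :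
    domainEnergy G P q α = energy P (cutPotential G P q α) := by
  funext k
  rw [domainEnergy, energy, partitionHamiltonian_eq hle]

/-- The derivative of the potential in the direction `β`. -/
noncomputable def cutPotentialDeriv (G P : SimpleGraph V) (α β : CutEdge G P → ℝ) (v : V) : ℝ :=
  -∑ e : CutEdge G P,
    ((if e.1.1 = v then β e else 0) + if e.1.2 = v then -β e / α e ^ 2 else 0)

theorem hasDerivAt_cutPotential (G P : SimpleGraph V) (q : V → ℝ) {a : ℝ → CutEdge G P → ℝ}
    {β : CutEdge G P → ℝ} {s : ℝ} (ha : ∀ e, HasDerivAt (fun t => a t e) (β e) s)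
    (h0 : ∀ e, a s e ≠ 0) (v : V) :
    HasDerivAt (fun t => cutPotential G P q (a t) v) (cutPotentialDeriv G P (a s) β v) s := by
  refine HasDerivAt.const_sub _ (HasDerivAt.fun_sum fun e _ => HasDerivAt.add ?_ ?_)
  · split_ifs
    · exact ha e
    · exact hasDerivAt_const _ _
  · split_ifs
    · exact (ha e).inv (h0 e)
    · exact hasDerivAt_const _ _

theorem sum_mul_cutPotentialDeriv (G P : SimpleGraph V) (α β : CutEdge G P → ℝ) (F : V → ℝ) :
    ∑ v, F v * cutPotentialDeriv G P α β v =
      ∑ e : CutEdge G P, β e * (F e.1.2 / α e ^ 2 - F e.1.1) := by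
  simp only [cutPotentialDeriv, mul_neg, Finset.mul_sum, Finset.sum_neg_distrib]
  rw [Finset.sum_comm, ← Finset.sum_neg_distrib]
  refine Finset.sum_congr rfl fun e _ => ?_
  simp only [mul_add, Finset.sum_add_distrib, mul_ite, mul_zero, Finset.sum_ite_eq,
    Finset.mem_univ, if_true]
  ring

theorem contDiffAt_cutPotential (G P : SimpleGraph V) (q : V → ℝ) {α : CutEdge G P → ℝ}
    (hα : ∀ e, α e ≠ 0) : ContDiffAt ℝ ∞ (cutPotential G P q) α := by
  refine contDiffAt_pi.2 fun v => contDiffAt_const.sub (ContDiffAt.sum fun e _ => ?_)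
  refine ContDiffAt.add ?_ ?_
  · split_ifs <;> fun_prop
  · split_ifs
    · exact ContDiffAt.inv (by fun_prop) (hα e)
    · exact contDiffAt_const

theorem isOpen_forall_ne_zero {ι : Type*} [Finite ι] : IsOpen {α : ι → ℝ | ∀ e, α e ≠ 0} := by
  simp only [Set.ofPred_forall]
  exact isOpen_iInter_of_finite fun e => isOpen_ne_fun (continuous_apply e) continuous_const

theorem contDiffAt_domainEnergy {G P : SimpleGraph V} (hle : P ≤ G) (q : V → ℝ)
    {α : CutEdge G P → ℝ} (hα : ∀ e, α e ≠ 0) : ContDiffAt ℝ ∞ (domainEnergy G P q) α := by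
  have : domainEnergy G P q = energy P ∘ cutPotential G P q := funext (domainEnergy_eq hle q)
  rw [this]
  exact (contDiff_energy P).contDiffAt.comp α (contDiffAt_cutPotential G P q hα)

end CutPotential

/-! ### First order perturbation theory for ground states -/

section HellmannFeynman

open Topology

variable {V : Type*} [Fintype V]

/-- First order perturbation theory: the equation for the derivative of the ground states. -/
theorem hamiltonian_mulVec_deriv {P : SimpleGraph V} {d ψ : ℝ → V → ℝ}
    {E : ℝ → P.ConnectedComponent → ℝ} {d' ψ' : V → ℝ} {E' : P.ConnectedComponent → ℝ} {s : ℝ}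
    (h : ∀ᶠ t in 𝓝 s, IsGroundState P (d t) (E t) (ψ t))
    (hd : ∀ v, HasDerivAt (fun t => d t v) (d' v) s)
    (hψ : ∀ v, HasDerivAt (fun t => ψ t v) (ψ' v) s)
    (hE : ∀ k, HasDerivAt (fun t => E t k) (E' k) s) (v : V) :
    (hamiltonian P (d s)).mulVec ψ' v = E s (P.connectedComponentMk v) * ψ' v +
      (E' (P.connectedComponentMk v) - d' v) * ψ s v := by
  have h1 : HasDerivAt (fun t => d t v * ψ t v - ∑ w, adjWeight P v w * ψ t w)
      ((d' v * ψ s v + d s v * ψ' v) - ∑ w, adjWeight P v w * ψ' w) s :=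
    ((hd v).mul (hψ v)).sub (HasDerivAt.fun_sum fun w _ => (hψ w).const_mul _)
  have h2 : HasDerivAt (fun t => E t (P.connectedComponentMk v) * ψ t v)
      (E' (P.connectedComponentMk v) * ψ s v + E s (P.connectedComponentMk v) * ψ' v) s :=
    (hE _).mul (hψ v)
  have h3 := h1.unique (h2.congr_of_eventuallyEq (h.mono fun t ht => by
    beta_reduce
    rw [← hamiltonian_mulVec_apply, ht.eigen]))
  rw [hamiltonian_mulVec_apply]
  linarith

/-- The Hellmann–Feynman formula, with arbitrary weights of the domains. -/
theorem hellmann_feynman {P : SimpleGraph V} {d ψ : ℝ → V → ℝ}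
    {E : ℝ → P.ConnectedComponent → ℝ} {d' ψ' : V → ℝ} {E' : P.ConnectedComponent → ℝ} {s : ℝ}
    (h : ∀ᶠ t in 𝓝 s, IsGroundState P (d t) (E t) (ψ t))
    (hd : ∀ v, HasDerivAt (fun t => d t v) (d' v) s)
    (hψ : ∀ v, HasDerivAt (fun t => ψ t v) (ψ' v) s)
    (hE : ∀ k, HasDerivAt (fun t => E t k) (E' k) s) (c : P.ConnectedComponent → ℝ) :
    ∑ v, c (P.connectedComponentMk v) * ψ s v ^ 2 * d' v =
      ∑ v, c (P.connectedComponentMk v) * ψ s v ^ 2 * E' (P.connectedComponentMk v) := by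
  have h1 := sum_weighted_hamiltonian_comm P (d s) c ψ' (ψ s)
  rw [← sub_eq_zero, ← Finset.sum_sub_distrib] at h1 ⊢
  rw [← neg_eq_zero, ← Finset.sum_neg_distrib, ← h1]
  refine Finset.sum_congr rfl fun v _ => ?_
  rw [hamiltonian_mulVec_deriv h hd hψ hE, h.self_of_nhds.eigen]
  ring

end HellmannFeynman

/-! ### Differentials of the domain energies and the linear relations between them -/

section EnergyDerivative

open Topology

theorem sum_domain_eq {V : Type*} [Fintype V] {P : SimpleGraph V}
    [DecidableEq P.ConnectedComponent] (w : V → ℝ) (x : P.ConnectedComponent → ℝ) :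
    ∑ v, w v * x (P.connectedComponentMk v) =
      ∑ k, (∑ v, if P.connectedComponentMk v = k then w v else 0) * x k := by
  simp only [Finset.sum_mul, ite_mul, zero_mul]
  rw [Finset.sum_comm]
  simp

/-- Multipliers have the same sign on all domains. -/
theorem sign_multiplier_eq {V : Type*} [LinearOrder V] {G P : SimpleGraph V} {α : CutEdge G P → ℝ}
    {ψ : V → ℝ} (hG : G.Connected) (hα : ∀ e, α e ≠ 0) (hψ : ∀ v, ψ v ≠ 0)
    {c : P.ConnectedComponent → ℝ}
    (hc : ∀ e : CutEdge G P, c (P.connectedComponentMk e.1.1) * ψ e.1.1 ^ 2 =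
        c (P.connectedComponentMk e.1.2) * ψ e.1.2 ^ 2 / α e ^ 2) (k l : P.ConnectedComponent) :
    SignType.sign (c k) = SignType.sign (c l) := by
  -- The squares in the relation are positive, so the sign is carried across each cut edge, and by
  -- connectedness of `G` to every domain.
  have hcut : ∀ e : CutEdge G P, SignType.sign (c (P.connectedComponentMk e.1.1)) =
      SignType.sign (c (P.connectedComponentMk e.1.2)) := by
    intro e
    have h1 : SignType.sign (ψ e.1.1 ^ 2) = 1 := sign_pos (by positivity [hψ e.1.1])
    have h2 : SignType.sign (ψ e.1.2 ^ 2 / α e ^ 2) = 1 :=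
      sign_pos (div_pos (by positivity [hψ e.1.2]) (by positivity [hα e]))
    have := congrArg SignType.sign (hc e)
    rwa [mul_div_assoc, sign_mul, sign_mul, h1, h2, mul_one, mul_one] at this
  have hadj : ∀ v w, G.Adj v w → SignType.sign (c (P.connectedComponentMk v)) =
      SignType.sign (c (P.connectedComponentMk w)) := by
    intro v w hvw
    by_cases hP : P.Adj v w
    · rw [connectedComponentMk_eq_of_adj hP]
    · rcases lt_or_gt_of_ne hvw.ne with h | h
      · exact hcut ⟨(v, w), h, hvw, hP⟩
      · exact (hcut ⟨(w, v), h, hvw.symm, fun h' => hP h'.symm⟩).symm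
  have := eq_of_reachable hadj (hG.preconnected (domainRep k) (domainRep l))
  simpa using this

/-- A nonzero functional vanishing on `R`, written in coordinates. It is the source of the Lagrange
multipliers. -/
theorem exists_annihilator {ι : Type*} [Fintype ι] {R : Submodule ℝ (ι → ℝ)} (hR : R ≠ ⊤) :
    ∃ C : ι → ℝ, C ≠ 0 ∧ ∀ x ∈ R, ∑ k, C k * x k = 0 := by
  classical
  obtain ⟨f, hf, hle⟩ := Submodule.exists_le_ker_of_lt_top R hR.lt_top
  have hfx : ∀ x, f x = ∑ k, f (Pi.single k 1) * x k := by
    intro x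
    rw [LinearMap.pi_apply_eq_sum_univ f x]
    refine Finset.sum_congr rfl fun k _ => ?_
    rw [smul_eq_mul, mul_comm]
    congr 2
    ext j
    simp [Pi.single_apply, eq_comm]
  refine ⟨fun k => f (Pi.single k 1), fun h => hf ?_, fun x hx => ?_⟩
  · ext x
    simpa using congrFun h x
  · rw [← hfx]
    exact LinearMap.mem_ker.1 (hle hx)

variable {V : Type*} [Fintype V] [LinearOrder V] {G P : SimpleGraph V} {q : V → ℝ}
  {α : CutEdge G P → ℝ} {E : P.ConnectedComponent → ℝ} {ψ : V → ℝ}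

/-- The derivative of the energies of the domains. -/
theorem sum_mul_fderiv_domainEnergy (hle : P ≤ G) (hα : ∀ e, α e ≠ 0)
    (hψ : IsGroundState P (cutPotential G P q α) E ψ) (β : CutEdge G P → ℝ)
    (c : P.ConnectedComponent → ℝ) :
    ∑ v, c (P.connectedComponentMk v) * ψ v ^ 2 *
        fderiv ℝ (domainEnergy G P q) α β (P.connectedComponentMk v) =
      ∑ e : CutEdge G P, β e * (c (P.connectedComponentMk e.1.2) * ψ e.1.2 ^ 2 / α e ^ 2 -
        c (P.connectedComponentMk e.1.1) * ψ e.1.1 ^ 2) := by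
  obtain ⟨Ψ, hΨs, hΨ0, -, hΨ⟩ := hψ.exists_contDiffAt
  set a : ℝ → CutEdge G P → ℝ := fun t => α + t • β with ha
  have ha0 : a 0 = α := by simp [ha]
  have had : HasDerivAt a β 0 := by
    simpa [ha] using ((hasDerivAt_id (0 : ℝ)).smul_const β).const_add α
  have hdd := hasDerivAt_cutPotential G P q (hasDerivAt_pi.1 had) (by rw [ha0]; exact hα)
  rw [ha0] at hdd
  have hac : Filter.Tendsto (fun t => cutPotential G P q (a t)) (𝓝 0)
      (𝓝 (cutPotential G P q α)) := by
    have : ContinuousAt (cutPotential G P q) (a 0) := by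
      rw [ha0]; exact (contDiffAt_cutPotential G P q hα).continuousAt
    have h2 : ContinuousAt (fun t => cutPotential G P q (a t)) 0 := this.comp had.continuousAt
    simpa only [ContinuousAt, ha0] using h2
  have hψd : HasDerivAt (fun t => Ψ (cutPotential G P q (a t)))
      (fderiv ℝ Ψ (cutPotential G P q α) (cutPotentialDeriv G P α β)) 0 := by
    refine HasFDerivAt.comp_hasDerivAt (0 : ℝ) (l := Ψ) (f := fun t => cutPotential G P q (a t))
      ?_ (hasDerivAt_pi.2 hdd)
    rw [ha0]
    exact (hΨs.differentiableAt (by simp)).hasFDerivAt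
  have hEd : HasDerivAt (fun t => domainEnergy G P q (a t))
      (fderiv ℝ (domainEnergy G P q) α β) 0 := by
    refine HasFDerivAt.comp_hasDerivAt (0 : ℝ) (l := domainEnergy G P q) ?_ had
    rw [ha0]
    exact ((contDiffAt_domainEnergy hle q hα).differentiableAt (by simp)).hasFDerivAt
  have hev : ∀ᶠ t in 𝓝 (0 : ℝ), IsGroundState P (cutPotential G P q (a t))
      (domainEnergy G P q (a t)) (Ψ (cutPotential G P q (a t))) := by
    filter_upwards [hac.eventually hΨ] with t ht
    rw [domainEnergy_eq hle]
    exact ht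
  have := hellmann_feynman hev hdd (hasDerivAt_pi.1 hψd) (hasDerivAt_pi.1 hEd) c
  simp only [ha0, hΨ0] at this
  rw [← this, sum_mul_cutPotentialDeriv G P α β fun v => c (P.connectedComponentMk v) * ψ v ^ 2]

/-- A linear relation between the derivatives of the energies of the domains, in terms of the
ground states. -/
theorem exists_multiplier (hle : P ≤ G) (hα : ∀ e, α e ≠ 0)
    (hψ : IsGroundState P (cutPotential G P q α) E ψ) {C : P.ConnectedComponent → ℝ}
    (hC : ∀ β, ∑ k, C k * fderiv ℝ (domainEnergy G P q) α β k = 0) :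
    ∃ c : P.ConnectedComponent → ℝ, (∀ k, ∃ n : ℝ, 0 < n ∧ C k = n * c k) ∧
      ∀ e : CutEdge G P, c (P.connectedComponentMk e.1.1) * ψ e.1.1 ^ 2 =
        c (P.connectedComponentMk e.1.2) * ψ e.1.2 ^ 2 / α e ^ 2 := by
  classical
  -- The mass of `ψ` on each domain, by which coefficients per domain and weights per vertex differ.
  set n : P.ConnectedComponent → ℝ :=
    fun k => ∑ v, if P.connectedComponentMk v = k then ψ v ^ 2 else 0 with hn
  have hnpos : ∀ k, 0 < n k := by
    intro k
    have := hψ.sum_weighted_pos k (c := fun l => if l = k then 1 else 0)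
      (fun l => by split_ifs <;> norm_num) (by simp)
    simpa [hn] using this
  refine ⟨fun k => C k / n k, fun k => ⟨n k, hnpos k, by field_simp [(hnpos k).ne']⟩,
    fun e => ?_⟩
  beta_reduce
  have h1 := sum_mul_fderiv_domainEnergy hle hα hψ (Pi.single e 1) fun k => C k / n k
  have h2 := sum_domain_eq (P := P) (fun v => ψ v ^ 2) fun k =>
    C k / n k * fderiv ℝ (domainEnergy G P q) α (Pi.single e 1) k
  have h3 : ∑ k, n k * (C k / n k * fderiv ℝ (domainEnergy G P q) α (Pi.single e 1) k) = 0 := by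
    rw [← hC (Pi.single e 1)]
    refine Finset.sum_congr rfl fun k _ => ?_
    have := (hnpos k).ne'
    field_simp
  have h4 : ∑ v, C (P.connectedComponentMk v) / n (P.connectedComponentMk v) * ψ v ^ 2 *
      fderiv ℝ (domainEnergy G P q) α (Pi.single e 1) (P.connectedComponentMk v) = 0 := by
    rw [← h3]
    convert h2 using 1
    · exact Finset.sum_congr rfl fun v _ => by ring
  rw [h4, Finset.sum_eq_single e] at h1
  · simp at h1
    linarith
  · intro b _ hb
    simp [Pi.single_eq_of_ne hb]
  · simp

/-- The derivatives of the energy differences are independent. -/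
theorem exists_fderiv_domainEnergy_eq (hG : G.Connected) (hle : P ≤ G) (hα : ∀ e, α e ≠ 0)
    (y : P.ConnectedComponent → ℝ) :
    ∃ β t, ∀ k, fderiv ℝ (domainEnergy G P q) α β k = y k + t := by
  obtain ⟨ψ, hψ, -⟩ := exists_isGroundState P (cutPotential G P q α)
  -- Including the constants in `R` forces an annihilator to have coefficient sum zero, which
  -- contradicts the common sign of the multipliers.
  set R : Submodule ℝ (P.ConnectedComponent → ℝ) :=
    LinearMap.range (fderiv ℝ (domainEnergy G P q) α).toLinearMap ⊔ ℝ ∙ (fun _ => (1 : ℝ))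
  have hR : R = ⊤ := by
    by_contra hR
    obtain ⟨C, hC0, hC⟩ := exists_annihilator hR
    have hsum : ∑ k, C k = 0 := by
      simpa using hC (fun _ => 1) (Submodule.mem_sup_right (Submodule.mem_span_singleton_self _))
    obtain ⟨c, hcC, hc⟩ := exists_multiplier hle hα hψ fun β =>
      hC _ (Submodule.mem_sup_left ⟨β, rfl⟩)
    have hsign : ∀ k l, SignType.sign (C k) = SignType.sign (C l) := by
      intro k l
      obtain ⟨n, hn, hk⟩ := hcC k
      obtain ⟨m, hm, hl⟩ := hcC l
      rw [hk, hl, sign_mul, sign_mul, sign_pos hn, sign_pos hm,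
        sign_multiplier_eq hG hα hψ.ne_zero hc k l]
    obtain ⟨k, hk⟩ := Function.ne_iff.1 hC0
    rcases lt_or_gt_of_ne hk with hk | hk
    · have : ∀ l, C l < 0 := fun l => sign_eq_neg_one_iff.1 ((hsign l k).trans (sign_neg hk))
      exact (Finset.sum_neg (fun l _ => this l) ⟨k, Finset.mem_univ k⟩).ne hsum
    · have : ∀ l, 0 < C l := fun l => sign_eq_one_iff.1 ((hsign l k).trans (sign_pos hk))
      exact (Finset.sum_pos (fun l _ => this l) ⟨k, Finset.mem_univ k⟩).ne' hsum
  have hy : y ∈ R := hR ▸ Submodule.mem_top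
  obtain ⟨x, ⟨β, rfl⟩, z, hz, hxz⟩ := Submodule.mem_sup.1 hy
  obtain ⟨t, rfl⟩ := Submodule.mem_span_singleton.1 hz
  refine ⟨β, -t, fun k => ?_⟩
  have := congrFun hxz k
  simp at this
  simp [← this]

end EnergyDerivative

/-! ### The equipartition set is a submanifold -/

section Equipartitions

open Topology

variable {V : Type*} [Fintype V] [LinearOrder V] {G P : SimpleGraph V} {q : V → ℝ}
  {α : CutEdge G P → ℝ}

/-- The energy differences relative to one reference domain `k₀` give `ν - 1` equations, and
`exists_fderiv_domainEnergy_eq` says that they form a submersion. -/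
theorem isSmoothSubmanifoldAt_equipartitionSet (hG : G.Connected) (hle : P ≤ G) {η : ℕ}
    (hη : (η : ℤ) = numCutEdges G P - ((numDomains P : ℤ) - 1))
    (hα : α ∈ equipartitionSet G P q) :
    IsSmoothSubmanifoldAt (equipartitionSet G P q) η α := by
  classical
  obtain ⟨v₀⟩ := hG.nonempty
  set k₀ := P.connectedComponentMk v₀
  set g : (CutEdge G P → ℝ) → ({k : P.ConnectedComponent // k ≠ k₀} → ℝ) :=
    fun a k => domainEnergy G P q a k - domainEnergy G P q a k₀ with hg
  have hgs : ∀ a, (∀ e, a e ≠ 0) → ContDiffAt ℝ ∞ g a := by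
    intro a ha
    have h1 := contDiffAt_pi.1 (contDiffAt_domainEnergy hle q ha)
    exact contDiffAt_pi.2 fun k => (h1 k).sub (h1 k₀)
  have hgd : ∀ β (k : {k : P.ConnectedComponent // k ≠ k₀}), fderiv ℝ g α β k =
      fderiv ℝ (domainEnergy G P q) α β k - fderiv ℝ (domainEnergy G P q) α β k₀ := by
    intro β k
    have h1 := hasFDerivAt_pi'.1
      ((contDiffAt_domainEnergy hle q hα.1).differentiableAt (by simp)).hasFDerivAt
    have h2 := hasFDerivAt_pi'.1 ((hgs α hα.1).differentiableAt (by simp)).hasFDerivAt k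
    have h3 := h2.unique ((h1 k).sub (h1 k₀))
    simpa using DFunLike.congr_fun h3 β
  refine isSmoothSubmanifoldAt_of_submersion isOpen_forall_ne_zero
    (g := g) (fun a ha => (hgs a ha).contDiffWithinAt) hα.1 ?_ ?_ ?_ ?_
  · ext k
    simp [hg, hα.2 k k₀]
  · intro z
    obtain ⟨β, t, h⟩ := exists_fderiv_domainEnergy_eq (q := q) hG hle hα.1
      fun k => if hk : k ≠ k₀ then z ⟨k, hk⟩ else 0
    refine ⟨β, funext fun k => ?_⟩
    rw [hgd, h, h]
    simp [k.2]
  · have h1 : Fintype.card {k : P.ConnectedComponent // k ≠ k₀} =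
        Fintype.card P.ConnectedComponent - 1 := by
      rw [Fintype.card_subtype_compl, Fintype.card_subtype_eq]
    have h2 : 0 < Fintype.card P.ConnectedComponent := Fintype.card_pos_iff.2 ⟨k₀⟩
    simp only [Module.finrank_fintype_fun_eq_card, numCutEdges, numDomains,
      Nat.card_eq_fintype_card] at hη ⊢
    rw [h1]
    omega
  · intro a ha
    refine ⟨fun h => funext fun k => ?_, fun h => ⟨ha, ?_⟩⟩
    · simp [hg, h.2 k k₀]
    · have : ∀ k, domainEnergy G P q a k = domainEnergy G P q a k₀ := by
        intro k
        by_cases hk : k = k₀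
        · rw [hk]
        · have := congrFun h ⟨k, hk⟩
          simpa [hg, sub_eq_zero] using this
      intro k l
      rw [this k, this l]

end Equipartitions
end NodalMorse

namespace NodalMorse

/-! ### Tangent spaces, critical points and eigenvectors of `H(G)` -/

section CriticalPoints

open Topology

variable {V : Type*} [Fintype V] [LinearOrder V] {G P : SimpleGraph V} {q : V → ℝ}
  {α : CutEdge G P → ℝ}

/-- Directions in which all the energies of the domains change at the same rate. -/
noncomputable def tangentSpace (G P : SimpleGraph V) (q : V → ℝ) (α : CutEdge G P → ℝ) :
    Submodule ℝ (CutEdge G P → ℝ) where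
  carrier := {β | ∀ k l, fderiv ℝ (domainEnergy G P q) α β k =
    fderiv ℝ (domainEnergy G P q) α β l}
  add_mem' {a b} ha hb k l := by simp [ha k l, hb k l]
  zero_mem' k l := by simp
  smul_mem' c a ha k l := by simp [ha k l]

theorem finrank_tangentSpace (hG : G.Connected) (hle : P ≤ G) {η : ℕ}
    (hη : (η : ℤ) = numCutEdges G P - ((numDomains P : ℤ) - 1)) (hα : ∀ e, α e ≠ 0) :
    Module.finrank ℝ (tangentSpace G P q α) = η := by
  classical
  obtain ⟨v₀⟩ := hG.nonempty
  set k₀ := P.connectedComponentMk v₀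
  set D := fderiv ℝ (domainEnergy G P q) α
  let L : (CutEdge G P → ℝ) →ₗ[ℝ] ({k : P.ConnectedComponent // k ≠ k₀} → ℝ) :=
    { toFun := fun β k => D β k - D β k₀
      map_add' := fun a b => by ext k; simp; ring
      map_smul' := fun c a => by ext k; simp; ring }
  have hker : tangentSpace G P q α = LinearMap.ker L := by
    ext β
    refine ⟨fun h => LinearMap.mem_ker.2 (funext fun k => sub_eq_zero.2 (h k k₀)), fun h => ?_⟩
    have : ∀ k, D β k = D β k₀ := by
      intro k
      by_cases hk : k = k₀
      · rw [hk]
      · exact sub_eq_zero.1 (congrFun (LinearMap.mem_ker.1 h) ⟨k, hk⟩)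
    intro k l
    exact (this k).trans (this l).symm
  have hsurj : LinearMap.range L = ⊤ := by
    refine LinearMap.range_eq_top.2 fun z => ?_
    obtain ⟨β, t, h⟩ := exists_fderiv_domainEnergy_eq (q := q) hG hle hα
      fun k => if hk : k ≠ k₀ then z ⟨k, hk⟩ else 0
    refine ⟨β, funext fun k => ?_⟩
    change D β k - D β k₀ = _
    rw [h, h]
    simp [k.2]
  have h0 := LinearMap.finrank_range_add_finrank_ker L
  rw [hsurj, finrank_top, ← hker] at h0
  have h1 : Fintype.card {k : P.ConnectedComponent // k ≠ k₀} =
      Fintype.card P.ConnectedComponent - 1 := by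
    rw [Fintype.card_subtype_compl, Fintype.card_subtype_eq]
  have h2 : 0 < Fintype.card P.ConnectedComponent := Fintype.card_pos_iff.2 ⟨k₀⟩
  simp only [Module.finrank_fintype_fun_eq_card, numCutEdges, numDomains,
    Nat.card_eq_fintype_card] at hη h0
  omega

theorem eventually_localExpr_eq {η : ℕ} (φ : SliceChart (equipartitionSet G P q) η α)
    (k : P.ConnectedComponent) :
    φ.localExpr (equipartitionEnergy G P q) =ᶠ[𝓝 φ.base]
      fun t => domainEnergy G P q (φ.param t) k := by
  filter_upwards [φ.eventually_param_mem] with t ht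
  exact equipartitionEnergy_eq G P q ht k

theorem contDiffAt_domainEnergy_param (hle : P ≤ G) {η : ℕ}
    (φ : SliceChart (equipartitionSet G P q) η α) :
    ContDiffAt ℝ ∞ (fun t => domainEnergy G P q (φ.param t)) φ.base := by
  refine ContDiffAt.comp φ.base (g := domainEnergy G P q) ?_ φ.contDiffAt_param
  rw [φ.param_base]
  exact contDiffAt_domainEnergy hle q φ.mem_set.1

theorem contDiffAt_localExpr (hG : G.Connected) (hle : P ≤ G) {η : ℕ}
    (φ : SliceChart (equipartitionSet G P q) η α) :
    ContDiffAt ℝ ∞ (φ.localExpr (equipartitionEnergy G P q)) φ.base := by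
  obtain ⟨v₀⟩ := hG.nonempty
  exact (contDiffAt_pi.1 (contDiffAt_domainEnergy_param hle φ)
    (P.connectedComponentMk v₀)).congr_of_eventuallyEq (eventually_localExpr_eq φ _)

/-- The domain `k` is arbitrary: comparing the formula for two domains later shows that the chart
directions lie in `tangentSpace`. -/
theorem hasFDerivAt_localExpr (hle : P ≤ G) {η : ℕ}
    (φ : SliceChart (equipartitionSet G P q) η α) (k : P.ConnectedComponent) :
    HasFDerivAt (φ.localExpr (equipartitionEnergy G P q))
      (((ContinuousLinearMap.proj k).comp (fderiv ℝ (domainEnergy G P q) α)).comp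
        (fderiv ℝ φ.param φ.base)) φ.base := by
  refine HasFDerivAt.congr_of_eventuallyEq ?_ (eventually_localExpr_eq φ k)
  have h1 : HasFDerivAt (domainEnergy G P q) (fderiv ℝ (domainEnergy G P q) α)
      (φ.param φ.base) := by
    rw [φ.param_base]
    exact ((contDiffAt_domainEnergy hle q φ.mem_set.1).differentiableAt (by simp)).hasFDerivAt
  have h2 := (φ.contDiffAt_param.differentiableAt (by simp)).hasFDerivAt
  exact (hasFDerivAt_pi'.1 h1 k).comp φ.base h2

/-- The inclusion follows from uniqueness of the derivative of the common energy; equality holds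
because both sides have dimension `η`. -/
theorem range_fderiv_param (hG : G.Connected) (hle : P ≤ G) {η : ℕ}
    (hη : (η : ℤ) = numCutEdges G P - ((numDomains P : ℤ) - 1))
    (φ : SliceChart (equipartitionSet G P q) η α) :
    LinearMap.range (fderiv ℝ φ.param φ.base).toLinearMap = tangentSpace G P q α := by
  refine Submodule.eq_of_le_of_finrank_eq ?_ ?_
  · rintro _ ⟨w, rfl⟩ k l
    exact DFunLike.congr_fun ((hasFDerivAt_localExpr hle φ k).unique
      (hasFDerivAt_localExpr hle φ l)) w
  · rw [finrank_tangentSpace hG hle hη φ.mem_set.1,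
      LinearMap.finrank_range_of_inj φ.injective_fderiv_param]
    simp

theorem isCriticalPointOn_iff (hG : G.Connected) (hle : P ≤ G) {η : ℕ}
    (hη : (η : ℤ) = numCutEdges G P - ((numDomains P : ℤ) - 1))
    (hα : α ∈ equipartitionSet G P q) :
    IsCriticalPointOn (equipartitionSet G P q) η (equipartitionEnergy G P q) α ↔
      ∀ β ∈ tangentSpace G P q α, ∀ k, fderiv ℝ (domainEnergy G P q) α β k = 0 := by
  have hsm := isSmoothSubmanifoldAt_equipartitionSet hG hle hη hα
  constructor
  · rintro ⟨-, h⟩ β hβ k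
    obtain ⟨φ⟩ := hsm
    rw [← range_fderiv_param hG hle hη φ] at hβ
    obtain ⟨w, rfl⟩ := hβ
    exact DFunLike.congr_fun ((hasFDerivAt_localExpr hle φ k).unique (h φ)) w
  · refine fun h => ⟨hsm, fun φ => ?_⟩
    obtain ⟨v₀⟩ := hG.nonempty
    convert hasFDerivAt_localExpr hle φ (P.connectedComponentMk v₀)
    ext w : 1
    refine (h _ ?_ _).symm
    rw [← range_fderiv_param hG hle hη φ]
    exact ⟨w, rfl⟩

/-- The pairing of `u` with the vector spanning the range of the perturbation of each cut edge. -/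
noncomputable def jump (α : CutEdge G P → ℝ) : (V → ℝ) →ₗ[ℝ] (CutEdge G P → ℝ) where
  toFun u e := u e.1.1 - u e.1.2 / α e
  map_add' u w := by ext e; simp; ring
  map_smul' c u := by ext e; simp; ring

/-- The transpose of `jump`. -/
noncomputable def jumpAdjoint (α : CutEdge G P → ℝ) : (CutEdge G P → ℝ) →ₗ[ℝ] (V → ℝ) where
  toFun x v := ∑ e : CutEdge G P,
    x e * ((if e.1.1 = v then 1 else 0) - if e.1.2 = v then (α e)⁻¹ else 0)
  map_add' x y := by ext v; simp [add_mul, Finset.sum_add_distrib]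
  map_smul' c x := by ext v; simp [Finset.mul_sum, mul_assoc]

theorem jump_apply {V : Type*} [LinearOrder V] {G P : SimpleGraph V} (α : CutEdge G P → ℝ)
    (u : V → ℝ) (e : CutEdge G P) : jump α u e = u e.1.1 - u e.1.2 / α e := rfl

theorem sum_mul_jumpAdjoint (u : V → ℝ) (x : CutEdge G P → ℝ) :
    ∑ v, u v * jumpAdjoint α x v = ∑ e, jump α u e * x e := by
  simp only [jumpAdjoint, LinearMap.coe_mk, AddHom.coe_mk, Finset.mul_sum, jump_apply]
  rw [Finset.sum_comm]
  refine Finset.sum_congr rfl fun e _ => ?_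
  simp only [mul_sub, mul_ite, mul_one, mul_zero, Finset.sum_sub_distrib,
    Finset.sum_ite_eq, Finset.mem_univ, if_true]
  ring

/-- The perturbation has rank one: `B(a) = -a b bᵀ` with `b = e_i - a⁻¹ e_j`. It is therefore
nonnegative for `a < 0` and kills every `u` with `u j = a * u i`. -/
theorem edgePerturbation_mulVec {i j : V} {a : ℝ} (ha : a ≠ 0) (u : V → ℝ) (v : V) :
    (edgePerturbation i j a).mulVec u v =
      -a * (u i - u j / a) * ((if i = v then 1 else 0) - if j = v then a⁻¹ else 0) := by
  have h : ∀ (i j : V) (x : ℝ), (Matrix.single i j x).mulVec u v = if i = v then x * u j else 0 := by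
    intro i j x
    by_cases h : i = v <;> simp [Matrix.mulVec, dotProduct, Matrix.single_apply, h]
  simp only [edgePerturbation, Matrix.add_mulVec, Pi.add_apply, h]
  by_cases h1 : i = v <;> by_cases h2 : j = v <;> simp [h1, h2] <;> field_simp <;> ring

theorem hamiltonian_cutPotential_mulVec (hle : P ≤ G) (hα : ∀ e, α e ≠ 0) (u : V → ℝ) (v : V) :
    (hamiltonian P (cutPotential G P q α)).mulVec u v =
      (hamiltonian G q).mulVec u v + jumpAdjoint α (fun e => -α e * jump α u e) v := by
  rw [← partitionHamiltonian_eq hle, partitionHamiltonian, Matrix.add_mulVec, Pi.add_apply,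
    Matrix.sum_mulVec, Finset.sum_apply]
  congr 1
  exact Finset.sum_congr rfl fun e _ => edgePerturbation_mulVec (hα e) u v

/-- A nowhere zero eigenvector of `H(G)` with nodal partition `P` solves the equation on the
domains for its induced parameters. -/
theorem IsNowhereZeroEigenvector.isGroundState (hle : P ≤ G) {μ : ℝ} {f : V → ℝ}
    (hf : IsNowhereZeroEigenvector G q μ f) (hP : nodalGraph G f = P)
    (hα : ∀ e, α e = f e.1.2 / f e.1.1) :
    IsGroundState P (cutPotential G P q α) (fun _ => μ) f := by
  have hα0 : ∀ e, α e ≠ 0 := fun e => by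
    rw [hα]; exact div_ne_zero (hf.2 _) (hf.2 _)
  refine ⟨hf.2, fun v w hvw => ?_, fun v => ?_⟩
  · rw [← hP] at hvw; exact hvw.2
  · have hj : (fun e => -α e * jump α f e) = 0 := by
      ext e
      have h1 := hf.2 e.1.1
      have h2 := hf.2 e.1.2
      simp only [jump_apply, hα e, Pi.zero_apply]
      field_simp
      ring
    rw [hamiltonian_cutPotential_mulVec hle hα0, hj, map_zero, Pi.zero_apply, add_zero]
    exact congrFun (Module.End.mem_eigenspace_iff.1 hf.1.1) v

theorem equipartition_of_isGroundState (hle : P ≤ G) (hα : ∀ e, α e ≠ 0) {μ : ℝ} {f : V → ℝ}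
    (hf : IsGroundState P (cutPotential G P q α) (fun _ => μ) f) : α ∈ equipartitionSet G P q := by
  refine ⟨hα, fun k l => ?_⟩
  rw [domainEnergy_eq hle, hf.energy_eq, hf.energy_eq]

/-- With weight one on all domains, each edge term of the Hellmann–Feynman formula contains `f_j² /
α_e² - f_i² = 0`. A tangent direction changes all energies at the same rate, and this rate times the
squared norm of `f` is thus zero. -/
theorem isCriticalPointOn_of_eigenvector (hG : G.Connected) (hle : P ≤ G) {η : ℕ}
    (hη : (η : ℤ) = numCutEdges G P - ((numDomains P : ℤ) - 1)) {μ : ℝ} {f : V → ℝ}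
    (hf : IsNowhereZeroEigenvector G q μ f) (hP : nodalGraph G f = P)
    (hα : ∀ e, α e = f e.1.2 / f e.1.1) :
    IsCriticalPointOn (equipartitionSet G P q) η (equipartitionEnergy G P q) α := by
  have hα0 : ∀ e, α e ≠ 0 := fun e => by
    rw [hα]; exact div_ne_zero (hf.2 _) (hf.2 _)
  have hgs := hf.isGroundState hle hP hα
  rw [isCriticalPointOn_iff hG hle hη (equipartition_of_isGroundState hle hα0 hgs)]
  intro β hβ k
  have h1 := sum_mul_fderiv_domainEnergy hle hα0 hgs β fun _ => 1
  have h2 : ∑ e : CutEdge G P, β e * (1 * f e.1.2 ^ 2 / α e ^ 2 - 1 * f e.1.1 ^ 2) = 0 := by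
    refine Finset.sum_eq_zero fun e _ => ?_
    have h3 := hf.2 e.1.1
    have h4 := hf.2 e.1.2
    rw [hα]
    field_simp
    ring
  rw [h2, Finset.sum_congr rfl fun v _ => by rw [hβ (P.connectedComponentMk v) k],
    ← Finset.sum_mul] at h1
  exact (mul_eq_zero.1 h1).resolve_left
    (hgs.sum_weighted_pos k (c := fun _ => 1) (fun _ => zero_le_one) zero_lt_one).ne'

theorem exists_eigenvector_of_isCriticalPointOn (hG : G.Connected) (hP : IsPartition G P)
    (hbip : (partitionGraph G P).IsBipartite) {η : ℕ}
    (hη : (η : ℤ) = numCutEdges G P - ((numDomains P : ℤ) - 1)) (hα : ∀ e, α e < 0)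
    (hcrit : IsCriticalPointOn (equipartitionSet G P q) η (equipartitionEnergy G P q) α) :
    ∃ f : V → ℝ, IsNowhereZeroEigenvector G q (equipartitionEnergy G P q α) f ∧
      nodalGraph G f = P ∧ α = inducedParameters G P f := by
  have hle := hP.le
  have hα0 : ∀ e, α e ≠ 0 := fun e => (hα e).ne
  have hS : α ∈ equipartitionSet G P q := hcrit.1.some.mem_set
  rw [isCriticalPointOn_iff hG hle hη hS] at hcrit
  obtain ⟨v₀⟩ := hG.nonempty
  obtain ⟨ψ, hψ, hψpos⟩ := exists_isGroundState P (cutPotential G P q α)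
  -- If the differential were onto, some direction would raise all energies at rate one; it would be
  -- tangent, contradicting criticality.
  obtain ⟨C, hC0, hC⟩ := exists_annihilator
    (R := LinearMap.range (fderiv ℝ (domainEnergy G P q) α).toLinearMap) (by
      intro htop
      have h1 : (fun _ => (1 : ℝ)) ∈
          LinearMap.range (fderiv ℝ (domainEnergy G P q) α).toLinearMap := htop ▸ Submodule.mem_top
      obtain ⟨β, hβ⟩ := h1
      have h2 : ∀ k, fderiv ℝ (domainEnergy G P q) α β k = 1 := fun k => congrFun hβ k
      have h3 := hcrit β (fun k l => by rw [h2, h2]) (P.connectedComponentMk v₀)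
      rw [h2] at h3
      exact one_ne_zero h3)
  obtain ⟨c, hcC, hc⟩ := exists_multiplier hle hα0 hψ fun β => hC _ ⟨β, rfl⟩
  have hsign := sign_multiplier_eq hG hα0 hψ.ne_zero hc
  obtain ⟨k₀, hk₀⟩ := Function.ne_iff.1 hC0
  have hc0 : ∀ k, c k ≠ 0 := by
    have h1 : c k₀ ≠ 0 := by
      obtain ⟨n, -, hn⟩ := hcC k₀
      intro h; rw [h, mul_zero] at hn; exact hk₀ hn
    intro k hk
    exact h1 (sign_eq_zero_iff.1 ((hsign k₀ k).trans (sign_eq_zero_iff.2 hk)))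
  have hcabs : ∀ e : CutEdge G P, |c (P.connectedComponentMk e.1.1)| * ψ e.1.1 ^ 2 =
      |c (P.connectedComponentMk e.1.2)| * ψ e.1.2 ^ 2 / α e ^ 2 := by
    intro e
    have := congrArg abs (hc e)
    rwa [abs_mul, abs_div, abs_mul, abs_sq, abs_sq, abs_sq] at this
  obtain ⟨col⟩ := hbip
  -- The two-colouring makes the sign flip across every cut edge, as negative parameters require.
  set ε : P.ConnectedComponent → ℝ := fun k => if col k = 0 then 1 else -1 with hε
  have hε2 : ∀ k, ε k ^ 2 = 1 := by
    intro k; simp only [hε]; split_ifs <;> norm_num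
  have hεcut : ∀ v w, G.Adj v w → ¬ P.Adj v w →
      ε (P.connectedComponentMk v) * ε (P.connectedComponentMk w) = -1 := by
    intro v w hG' hP'
    have hne : P.connectedComponentMk v ≠ P.connectedComponentMk w := fun h =>
      hP' (hP.adj_of_reachable v w (SimpleGraph.ConnectedComponent.exact h) hG')
    have hcol : col (P.connectedComponentMk v) ≠ col (P.connectedComponentMk w) :=
      col.valid ⟨hne, v, w, hG', hP', rfl, rfl⟩
    simp only [hε]
    split_ifs with h1 h2 h2
    · exact absurd (h1.trans h2.symm) hcol
    · norm_num
    · norm_num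
    · exact absurd (by omega) hcol
  -- With this factor `f² = |c| ψ²`, so the multiplier relation reads `f_i² = f_j² / α_e²`.
  set m : P.ConnectedComponent → ℝ := fun k => ε k * Real.sqrt |c k| with hm
  have hm0 : ∀ k, m k ≠ 0 := fun k =>
    mul_ne_zero (fun h => by have := hε2 k; rw [h] at this; norm_num at this)
      (Real.sqrt_ne_zero'.2 (abs_pos.2 (hc0 k)))
  have hm2 : ∀ k, m k ^ 2 = |c k| := fun k => by
    simp only [hm]; rw [mul_pow, hε2, one_mul, Real.sq_sqrt (abs_nonneg _)]
  have hgs := hψ.rescale hm0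
  set f : V → ℝ := fun v => m (P.connectedComponentMk v) * ψ v with hf
  have hneg : ∀ v w, G.Adj v w → ¬ P.Adj v w → f v * f w < 0 := by
    intro v w hG' hP'
    have h1 := hεcut v w hG' hP'
    have h2 := Real.sqrt_pos.2 (abs_pos.2 (hc0 (P.connectedComponentMk v)))
    have h3 := Real.sqrt_pos.2 (abs_pos.2 (hc0 (P.connectedComponentMk w)))
    have h4 : f v * f w = -(Real.sqrt |c (P.connectedComponentMk v)| *
        Real.sqrt |c (P.connectedComponentMk w)| * ψ v * ψ w) := by
      simp only [hf, hm]
      linear_combination (Real.sqrt |c (P.connectedComponentMk v)| *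
        Real.sqrt |c (P.connectedComponentMk w)| * ψ v * ψ w) * h1
    rw [h4]
    have := hψpos v
    have := hψpos w
    exact neg_neg_of_pos (by positivity)
  -- The squares agree, and both sides are negative.
  have hind : ∀ e, α e = f e.1.2 / f e.1.1 := by
    intro e
    have h1 := hcabs e
    rw [← hm2, ← hm2, ← mul_pow, ← mul_pow] at h1
    change f e.1.1 ^ 2 = f e.1.2 ^ 2 / α e ^ 2 at h1
    have hf1 := hgs.ne_zero e.1.1
    have h2 : (f e.1.2 / f e.1.1) ^ 2 = α e ^ 2 := by
      rw [div_pow, h1]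
      have := hgs.ne_zero e.1.2
      have := hα0 e
      change f e.1.2 ≠ 0 at *
      field_simp
    have h3 : f e.1.2 / f e.1.1 < 0 := by
      have := hneg _ _ e.2.2.1 e.2.2.2
      rw [div_neg_iff]
      rcases mul_neg_iff.1 this with h | h
      · exact Or.inr ⟨h.2, h.1⟩
      · exact Or.inl ⟨h.2, h.1⟩
    rcases sq_eq_sq_iff_eq_or_eq_neg.1 h2 with h | h
    · exact h.symm
    · linarith [hα e]
  refine ⟨f, ⟨⟨Module.End.mem_eigenspace_iff.2 (funext fun v => ?_), fun h =>
    hgs.ne_zero v₀ (congrFun h v₀)⟩, hgs.ne_zero⟩, ?_, funext hind⟩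
  · have h1 := hgs.eigen v
    rw [hamiltonian_cutPotential_mulVec hle hα0] at h1
    have hj : (fun e => -α e * jump α f e) = 0 := by
      ext e
      have h1 := hgs.ne_zero e.1.1
      have h2 := hgs.ne_zero e.1.2
      change f e.1.1 ≠ 0 at h1
      change f e.1.2 ≠ 0 at h2
      simp only [jump_apply, hind e, Pi.zero_apply]
      field_simp
      ring
    rw [hj, map_zero, Pi.zero_apply, add_zero, ← domainEnergy_eq hle,
      ← equipartitionEnergy_eq G P q hS] at h1
    exact h1
  · ext v w
    refine ⟨fun h => ?_, fun h => ⟨hle h, hgs.pos_of_adj v w h⟩⟩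
    by_contra hP'
    exact absurd h.2 (hneg v w h.1 hP').not_gt

end CriticalPoints
end NodalMorse

namespace NodalMorse

/-! ### Linear algebra: inertia of a Schur complement -/

section IndexCount

variable {V C : Type*} [Fintype V] [Fintype C]

theorem finrank_map_of_forall {X Y : Type*} [AddCommGroup X] [Module ℝ X] [AddCommGroup Y]
    [Module ℝ Y] (T : X →ₗ[ℝ] Y) (W : Submodule ℝ X) (h : ∀ v ∈ W, T v = 0 → v = 0) :
    Module.finrank ℝ (W.map T) = Module.finrank ℝ W := by
  rw [← LinearMap.range_domRestrict]
  refine LinearMap.finrank_range_of_inj ((injective_iff_map_eq_zero _).2 fun v hv => ?_)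
  exact Subtype.ext (h v v.2 hv)

variable {N K : (V → ℝ) →ₗ[ℝ] (V → ℝ)} {J : (V → ℝ) →ₗ[ℝ] (C → ℝ)}
  {Jt : (C → ℝ) →ₗ[ℝ] (V → ℝ)} {a : C → ℝ} {f : V → ℝ}

/-- Negative directions of `N = K - Jᵀ a J` produce negative directions of the Schur complement
`a⁻¹ - J K⁻¹ Jᵀ`. -/
theorem exists_negative_subspace (hJ : ∀ u x, dotProduct u (Jt x) = dotProduct (J u) x)
    (ha : ∀ e, 0 < a e) (hKN : ∀ u, K u = N u + Jt (fun e => a e * J u e))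
    (hK : ∀ u w, dotProduct u (K w) = dotProduct (K u) w) (hKpos : ∀ u, 0 ≤ dotProduct u (K u))
    (hf : f ≠ 0) (hKf : K f = 0) (hJf : J f = 0) {Eneg : Submodule ℝ (V → ℝ)}
    (hE : ∀ v ∈ Eneg, v ≠ 0 → dotProduct v (N v) < 0) :
    ∃ W : Submodule ℝ (C → ℝ), Module.finrank ℝ Eneg + 1 ≤
      Module.finrank ℝ W + Module.finrank ℝ (LinearMap.ker K) ∧
      ∀ x ∈ W, x ≠ 0 → ∃ u, K u = Jt x ∧ ∑ e, x e ^ 2 / a e < dotProduct u (Jt x) := by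
  let T : (V → ℝ) →ₗ[ℝ] (C → ℝ) :=
    { toFun := fun v e => a e * J v e
      map_add' := fun u v => by ext e; simp [mul_add]
      map_smul' := fun c u => by ext e; simp [mul_left_comm] }
  have hT : ∀ u, Jt (T u) = K u - N u := fun u => by rw [hKN u]; simp [T]
  -- For `v` in this space choose `z` with `K z = N v`. Since `Jt (T v) = K v - N v`, the vector `v
  -- - z` solves the equation with right-hand side `Jt (T v)`.
  set W' : Submodule ℝ (V → ℝ) := Eneg ⊓ (LinearMap.range K).comap N with hW'
  have key : ∀ v ∈ W', v ≠ 0 →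
      ∃ u, K u = Jt (T v) ∧ ∑ e, T v e ^ 2 / a e < dotProduct u (Jt (T v)) := by
    rintro v ⟨hvE, z, hz⟩ hv0
    refine ⟨v - z, by rw [map_sub, hz, hT], ?_⟩
    have h1 : ∑ e, T v e ^ 2 / a e = dotProduct v (Jt (T v)) := by
      rw [hJ, dotProduct]
      refine Finset.sum_congr rfl fun e _ => ?_
      have := (ha e).ne'
      simp only [T, LinearMap.coe_mk, AddHom.coe_mk]
      field_simp
    have h2 : dotProduct z (Jt (T v)) = dotProduct v (N v) - dotProduct z (K z) := by
      rw [hT, dotProduct_sub, hK z v, hz, dotProduct_comm]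
    rw [h1, sub_dotProduct, h2]
    linarith [hE v hvE hv0, hKpos z]
  have hTinj : ∀ v ∈ W', T v = 0 → v = 0 := by
    intro v hv hTv
    by_contra hv0
    obtain ⟨u, -, hu⟩ := key v hv hv0
    rw [hTv] at hu
    simp at hu
  refine ⟨W'.map T, ?_, ?_⟩
  · rw [finrank_map_of_forall T W' hTinj]
    have hNinj : ∀ v ∈ Eneg, N v = 0 → v = 0 := by
      intro v hv hNv
      by_contra hv0
      have := hE v hv hv0
      rw [hNv] at this
      simp at this
    set A := Eneg.map N with hA
    have hAfin : Module.finrank ℝ A = Module.finrank ℝ Eneg := finrank_map_of_forall N Eneg hNinj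
    have h1 : Module.finrank ℝ (A ⊓ LinearMap.range K : Submodule ℝ (V → ℝ)) ≤
        Module.finrank ℝ W' := by
      refine (Submodule.finrank_mono ?_).trans (Submodule.finrank_map_le N W')
      rintro _ ⟨⟨v, hv, rfl⟩, hr⟩
      exact ⟨v, ⟨hv, hr⟩, rfl⟩
    have hKorth : ∀ w, dotProduct f (K w) = 0 := fun w => by rw [hK, hKf, zero_dotProduct]
    have hNorth : ∀ w, dotProduct f (N w) = 0 := fun w => by
      have : N w = K w - Jt (T w) := by rw [hT]; abel
      rw [this, dotProduct_sub, hKorth, hJ, hJf, zero_dotProduct, sub_zero]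
    -- The ranges of `N` and `K` are both orthogonal to `f`, so together they miss a dimension: this
    -- is the `+ 1` in the count.
    have h2 : A ⊔ LinearMap.range K < ⊤ := by
      rw [lt_top_iff_ne_top]
      intro htop
      have hfm : f ∈ A ⊔ LinearMap.range K := htop ▸ Submodule.mem_top
      obtain ⟨_, ⟨v, -, rfl⟩, _, ⟨w, rfl⟩, hvw⟩ := Submodule.mem_sup.1 hfm
      have : dotProduct f f = 0 := by
        nth_rewrite 2 [← hvw]
        rw [dotProduct_add, hNorth, hKorth, add_zero]
      exact hf (dotProduct_self_eq_zero.1 this)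
    have h3 := Submodule.finrank_lt_finrank_of_lt h2
    rw [finrank_top] at h3
    have h4 := Submodule.finrank_sup_add_finrank_inf_eq A (LinearMap.range K)
    have h5 := LinearMap.finrank_range_add_finrank_ker K
    omega
  · rintro _ ⟨v, hv, rfl⟩ hx
    exact key v hv fun h => hx (by rw [h, map_zero])

/-- The dimension of the negative directions of the Schur complement `a⁻¹ - J K⁻¹ Jᵀ` is bounded by
means of the positive directions of `N = K - Jᵀ a J`. -/
theorem finrank_negative_subspace_le (hJ : ∀ u x, dotProduct u (Jt x) = dotProduct (J u) x)
    (ha : ∀ e, 0 < a e) (hKN : ∀ u, K u = N u + Jt (fun e => a e * J u e))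
    {Epos : Submodule ℝ (V → ℝ)} (hE : ∀ v ∈ Epos, v ≠ 0 → 0 < dotProduct v (N v))
    (hK : ∀ u w, dotProduct u (K w) = dotProduct (K u) w) {W : Submodule ℝ (C → ℝ)}
    (hW : ∀ x ∈ W, x ≠ 0 → ∃ u, K u = Jt x ∧ ∑ e, x e ^ 2 / a e < dotProduct u (Jt x)) :
    Module.finrank ℝ W + Module.finrank ℝ (LinearMap.ker K) + Module.finrank ℝ Epos ≤
      Fintype.card V := by
  have hN : ∀ u, dotProduct u (N u) = dotProduct u (K u) - ∑ e, a e * J u e ^ 2 := by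
    intro u
    rw [hKN u, dotProduct_add, hJ]
    have : dotProduct (J u) (fun e => a e * J u e) = ∑ e, a e * J u e ^ 2 :=
      Finset.sum_congr rfl fun e _ => by ring
    rw [this]; ring
  have haJ : ∀ u, 0 ≤ ∑ e, a e * J u e ^ 2 := fun u =>
    Finset.sum_nonneg fun e _ => mul_nonneg (ha e).le (sq_nonneg _)
  have hxa : ∀ x : C → ℝ, 0 ≤ ∑ e, x e ^ 2 / a e := fun x =>
    Finset.sum_nonneg fun e _ => div_nonneg (sq_nonneg _) (ha e).le
  have hJtinj : ∀ x ∈ W, Jt x = 0 → x = 0 := by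
    intro x hx h0
    by_contra hx0
    obtain ⟨u, -, hu⟩ := hW x hx hx0
    rw [h0, dotProduct_zero] at hu
    exact hu.not_ge (hxa x)
  -- `N` is nonpositive on this space, so it meets `Epos` trivially; its dimension is that of `W`
  -- plus that of the kernel of `K`.
  set U : Submodule ℝ (V → ℝ) := (W.map Jt).comap K with hU
  have hUle : ∀ u ∈ U, dotProduct u (N u) ≤ 0 := by
    rintro u ⟨x, hx, hxu⟩
    by_cases hx0 : x = 0
    · rw [hx0, map_zero] at hxu
      rw [hN, ← hxu, dotProduct_zero]
      linarith [haJ u]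
    · obtain ⟨u', hu', hlt⟩ := hW x hx hx0
      have h1 : dotProduct u' (Jt x) = dotProduct u (K u) := by
        rw [hxu, hK, hu', hxu, dotProduct_comm]
      rw [h1] at hlt
      -- Cauchy–Schwarz with weights `a⁻¹` and `a`. As `∑ x² / a` is smaller than `⟨u, K u⟩`, the
      -- other factor `∑ a (J u)²` is at least `⟨u, K u⟩`.
      have hcs : dotProduct u (K u) ^ 2 ≤
          (∑ e, x e ^ 2 / a e) * ∑ e, a e * J u e ^ 2 := by
        have h2 := Finset.sum_mul_sq_le_sq_mul_sq Finset.univ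
          (fun e => x e / Real.sqrt (a e)) (fun e => Real.sqrt (a e) * J u e)
        have e1 : ∀ e, x e / Real.sqrt (a e) * (Real.sqrt (a e) * J u e) = J u e * x e := by
          intro e
          have := (Real.sqrt_pos.2 (ha e)).ne'
          field_simp
        simp only [e1, div_pow, mul_pow, Real.sq_sqrt (ha _).le] at h2
        rw [← hxu, hJ]
        exact h2
      rw [hN]
      by_contra hcon
      nlinarith [hxa x, haJ u]
  have hfinU : Module.finrank ℝ U =
      Module.finrank ℝ W + Module.finrank ℝ (LinearMap.ker K) := by
    have h1 := LinearMap.finrank_range_add_finrank_ker (K.domRestrict U)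
    have hker : LinearMap.ker K ≤ U := fun u hu => by
      rw [hU, Submodule.mem_comap, LinearMap.mem_ker.1 hu]
      exact zero_mem _
    have h2 : Module.finrank ℝ (LinearMap.ker (K.domRestrict U)) =
        Module.finrank ℝ (LinearMap.ker K) := by
      have : LinearMap.ker (K.domRestrict U) = (LinearMap.ker K).comap U.subtype := rfl
      rw [this]
      exact (Submodule.comapSubtypeEquivOfLe hker).finrank_eq
    have h3 : LinearMap.range (K.domRestrict U) = W.map Jt := by
      rw [LinearMap.range_domRestrict]
      refine le_antisymm (Submodule.map_comap_le _ _) ?_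
      rintro _ ⟨x, hx, rfl⟩
      by_cases hx0 : x = 0
      · rw [hx0, map_zero]; exact zero_mem _
      · obtain ⟨u, hu, -⟩ := hW x hx hx0
        exact ⟨u, ⟨x, hx, hu.symm⟩, hu⟩
    rw [h2, h3, finrank_map_of_forall Jt W hJtinj] at h1
    exact h1.symm
  have hdisj : Disjoint U Epos := by
    rw [Submodule.disjoint_def]
    intro u hu hu'
    by_contra h0
    exact (hUle u hu).not_gt (hE u hu' h0)
  have := Submodule.finrank_add_finrank_le_of_disjoint hdisj
  rw [hfinU] at this
  simpa using this

end IndexCount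

/-! ### Spectral subspaces and the position of a simple eigenvalue -/

section Spectrum

variable {V : Type*} [Fintype V] [DecidableEq V] {M : Matrix V V ℝ}

/-- A spectral subspace of a symmetric matrix. -/
theorem exists_spectral_subspace (hM : M.IsHermitian) (μ : ℝ) (p : V → Prop) [DecidablePred p] :
    ∃ E : Submodule ℝ (V → ℝ), Module.finrank ℝ E = Fintype.card {j // p j} ∧
      ∀ v ∈ E, v ≠ 0 → ∃ c : {j // p j} → ℝ, c ≠ 0 ∧
        dotProduct v (M.mulVec v - μ • v) = ∑ j, c j ^ 2 * (hM.eigenvalues j - μ) := by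
  set b : V → V → ℝ := fun j => (hM.eigenvectorBasis j).ofLp with hb
  have hbM : ∀ j, M.mulVec (b j) = hM.eigenvalues j • b j := fun j =>
    hM.mulVec_eigenvectorBasis j
  have hbo : ∀ i j, dotProduct (b i) (b j) = if i = j then 1 else 0 := by
    intro i j
    have := orthonormal_iff_ite.1 hM.eigenvectorBasis.orthonormal i j
    rw [← this, EuclideanSpace.inner_eq_star_dotProduct, dotProduct_comm]
    rfl
  have hli : LinearIndependent ℝ (fun j : {j // p j} => b j) := by
    have h1 : LinearIndependent ℝ b := by
      have := hM.eigenvectorBasis.orthonormal.linearIndependent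
      exact this.map' (WithLp.linearEquiv 2 ℝ (V → ℝ)).toLinearMap (LinearEquiv.ker _)
    exact h1.comp _ Subtype.val_injective
  refine ⟨Submodule.span ℝ (Set.range fun j : {j // p j} => b j), finrank_span_eq_card hli,
    fun v hv hv0 => ?_⟩
  obtain ⟨c, rfl⟩ := (Submodule.mem_span_range_iff_exists_fun ℝ).1 hv
  refine ⟨c, fun h => hv0 (by simp [h]), ?_⟩
  have h1 : M.mulVec (∑ j, c j • b j) - μ • ∑ j, c j • b j =
      ∑ j, (c j * (hM.eigenvalues j - μ)) • b j := by
    rw [Matrix.mulVec_sum, Finset.smul_sum, ← Finset.sum_sub_distrib]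
    refine Finset.sum_congr rfl fun j _ => ?_
    rw [Matrix.mulVec_smul, hbM, smul_smul, smul_smul, ← sub_smul]
    congr 1; ring
  rw [h1, sum_dotProduct]
  refine Finset.sum_congr rfl fun i _ => ?_
  rw [dotProduct_sum, Finset.sum_eq_single i]
  · simp [hbo]; ring
  · intro j _ hj
    have : (i : V) ≠ j := fun h => hj (Subtype.ext h.symm)
    simp [hbo, this]
  · simp

/-- A simple eigenvalue occupies only one position in the ordered spectrum. -/
theorem eigenvalues₀_inj_of_simple (hM : M.IsHermitian) {μ : ℝ}
    (hsimple : Module.finrank ℝ (Module.End.eigenspace M.mulVecLin μ) ≤ 1)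
    {k l : Fin (Fintype.card V)} (hk : hM.eigenvalues₀ k = μ) (hl : hM.eigenvalues₀ l = μ) :
    k = l := by
  set eq := (Fintype.equivOfCardEq (Fintype.card_fin (Fintype.card V)) :
    Fin (Fintype.card V) ≃ V) with heq
  have hev : ∀ k, hM.eigenvalues (eq k) = hM.eigenvalues₀ k := fun k => by
    simp only [Matrix.IsHermitian.eigenvalues]
    exact congrArg _ (eq.symm_apply_apply k)
  by_contra hne
  have hmem : ∀ k, hM.eigenvalues₀ k = μ →
      (hM.eigenvectorBasis (eq k)).ofLp ∈ Module.End.eigenspace M.mulVecLin μ := fun k hk => by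
    rw [Module.End.mem_eigenspace_iff, Matrix.mulVecLin_apply, hM.mulVec_eigenvectorBasis, hev, hk]
  obtain ⟨v, hv⟩ := finrank_le_one_iff.1 hsimple
  obtain ⟨c, hc⟩ := hv ⟨_, hmem k hk⟩
  obtain ⟨c', hc'⟩ := hv ⟨_, hmem l hl⟩
  have hbo : ∀ i j : V, dotProduct (hM.eigenvectorBasis i).ofLp (hM.eigenvectorBasis j).ofLp =
      if i = j then 1 else 0 := by
    intro i j
    have := orthonormal_iff_ite.1 hM.eigenvectorBasis.orthonormal i j
    rw [← this, EuclideanSpace.inner_eq_star_dotProduct, dotProduct_comm]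
    rfl
  have h1 : c • (v : V → ℝ) = (hM.eigenvectorBasis (eq k)).ofLp := congrArg Subtype.val hc
  have h2 : c' • (v : V → ℝ) = (hM.eigenvectorBasis (eq l)).ofLp := congrArg Subtype.val hc'
  have h3 := hbo (eq k) (eq l)
  have h4 := hbo (eq k) (eq k)
  have h5 := hbo (eq l) (eq l)
  rw [if_neg (fun h => hne (eq.injective h))] at h3
  rw [← h1] at h3 h4
  rw [← h2] at h3 h5
  simp only [smul_dotProduct, dotProduct_smul, smul_eq_mul, if_true] at h3 h4 h5
  have : c * (c * dotProduct (v : V → ℝ) v) * (c' * (c' * dotProduct (v : V → ℝ) v)) =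
    (c' * (c * dotProduct (v : V → ℝ) v)) ^ 2 := by ring
  rw [h3, h4, h5] at this
  norm_num at this

/-- The numbers of eigenvalues below and above a simple eigenvalue. -/
theorem card_eigenvalues_lt (hM : M.IsHermitian) {μ : ℝ}
    (hsimple : Module.finrank ℝ (Module.End.eigenspace M.mulVecLin μ) ≤ 1)
    {i : Fin (Fintype.card V)} (hi : sortedEigenvalue hM i = μ) :
    Fintype.card {j // hM.eigenvalues j < μ} = i ∧
      Fintype.card {j // μ < hM.eigenvalues j} = Fintype.card V - (i + 1) := by
  set eq := (Fintype.equivOfCardEq (Fintype.card_fin (Fintype.card V)) :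
    Fin (Fintype.card V) ≃ V) with heq
  have hev : ∀ k, hM.eigenvalues (eq k) = hM.eigenvalues₀ k := fun k => by
    simp only [Matrix.IsHermitian.eigenvalues]
    exact congrArg _ (eq.symm_apply_apply k)
  -- `eigenvalues₀` is decreasing, so the `(i + 1)`-st smallest eigenvalue sits at `i.rev` and the
  -- smaller ones come after it.
  have hanti := hM.eigenvalues₀_antitone
  have hne : ∀ k, k ≠ i.rev → hM.eigenvalues₀ k ≠ μ := fun k hk h =>
    hk (eigenvalues₀_inj_of_simple hM hsimple h hi)
  have hlt : ∀ k, hM.eigenvalues₀ k < μ ↔ i.rev < k := by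
    intro k
    refine ⟨fun h => ?_, fun h => lt_of_le_of_ne ?_ (hne k h.ne')⟩
    · by_contra hk
      exact h.not_ge (hi ▸ hanti (not_lt.1 hk))
    · exact hi ▸ hanti h.le
  have hgt : ∀ k, μ < hM.eigenvalues₀ k ↔ k < i.rev := by
    intro k
    refine ⟨fun h => ?_, fun h => lt_of_le_of_ne ?_ (hne k h.ne).symm⟩
    · by_contra hk
      exact h.not_ge (hi ▸ hanti (not_lt.1 hk))
    · exact hi ▸ hanti h.le
  constructor
  · have h1 : Fintype.card {j // hM.eigenvalues j < μ} = Fintype.card {k // k ∈ Finset.Ioi i.rev} :=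
      (Fintype.card_congr (eq.subtypeEquiv fun k => by rw [Finset.mem_Ioi, hev, hlt])).symm
    rw [h1, Fintype.card_coe, Fin.card_Ioi, Fin.val_rev]
    omega
  · have h1 : Fintype.card {j // μ < hM.eigenvalues j} = Fintype.card {k // k ∈ Finset.Iio i.rev} :=
      (Fintype.card_congr (eq.subtypeEquiv fun k => by rw [Finset.mem_Iio, hev, hgt])).symm
    rw [h1, Fintype.card_coe, Fin.card_Iio, Fin.val_rev]

end Spectrum
end NodalMorse

namespace NodalMorse

/-! ### The second derivative of the energy on the equipartition set -/

section Hessian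

open Topology

/-- First and second derivatives of a smooth function along a line. -/
theorem hasDerivAt_along_line {X Y : Type*} [NormedAddCommGroup X] [NormedSpace ℝ X]
    [NormedAddCommGroup Y] [NormedSpace ℝ Y] {h : X → Y} {p : X} (hh : ContDiffAt ℝ ∞ h p)
    (w : X) :
    (∀ᶠ s in 𝓝 (0 : ℝ), HasDerivAt (fun t : ℝ => h (p + t • w)) (fderiv ℝ h (p + s • w) w) s) ∧
      HasDerivAt (fun s : ℝ => fderiv ℝ h (p + s • w) w) (fderiv ℝ (fderiv ℝ h) p w w) 0 := by
  have hline : ∀ s : ℝ, HasDerivAt (fun t : ℝ => p + t • w) w s := fun s => by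
    simpa using ((hasDerivAt_id s).smul_const w).const_add p
  have hdiff : ∀ᶠ x in 𝓝 p, DifferentiableAt ℝ h x := by
    have h1 : ContDiffAt ℝ 1 h p := hh.of_le (by exact_mod_cast le_top)
    filter_upwards [h1.eventually (by simp)] with x hx using hx.differentiableAt (by simp)
  have htend : Filter.Tendsto (fun t : ℝ => p + t • w) (𝓝 0) (𝓝 p) := by
    simpa using (hline 0).continuousAt.tendsto
  constructor
  · filter_upwards [htend.eventually hdiff] with s hs
    exact HasFDerivAt.comp_hasDerivAt s (l := h) (f := fun t : ℝ => p + t • w) hs.hasFDerivAt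
      (hline s)
  · have h1 : DifferentiableAt ℝ (fderiv ℝ h) p :=
      (hh.fderiv_right (m := 1) (by norm_cast)).differentiableAt (by simp)
    have h2 : HasDerivAt (fun t : ℝ => fderiv ℝ h (p + t • w)) (fderiv ℝ (fderiv ℝ h) p w) 0 :=
      HasFDerivAt.comp_hasDerivAt (0 : ℝ) (l := fderiv ℝ h) (f := fun t : ℝ => p + t • w)
        (by simpa using h1.hasFDerivAt) (hline 0)
    simpa using h2.clm_apply (hasDerivAt_const (0 : ℝ) w)

/-- The difference of `H(P; α)` and an energy, as a linear map. -/
noncomputable def shifted {V : Type*} [Fintype V] (P : SimpleGraph V) (d : V → ℝ) (μ : ℝ) :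
    (V → ℝ) →ₗ[ℝ] (V → ℝ) :=
  (hamiltonian P d).mulVecLin - μ • LinearMap.id

theorem shifted_apply {V : Type*} [Fintype V] (P : SimpleGraph V) (d : V → ℝ) (μ : ℝ) 
    (u : V → ℝ) :
    shifted P d μ u = (hamiltonian P d).mulVec u - μ • u := rfl

variable {V : Type*} [Fintype V] [LinearOrder V] {G P : SimpleGraph V} {q : V → ℝ}
  {α : CutEdge G P → ℝ}

/-- The rescaled tangent vector to `Q(P)` attached to a coordinate vector. -/
noncomputable def scaledTangent {η : ℕ} (φ : SliceChart (equipartitionSet G P q) η α)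
    (f : V → ℝ) : (Fin η → ℝ) →ₗ[ℝ] (CutEdge G P → ℝ) where
  toFun w e := f e.1.1 * fderiv ℝ φ.param φ.base w e
  map_add' a b := by ext e; simp [mul_add]
  map_smul' c a := by ext e; simp [mul_left_comm]

/-- The Hessian of the energy on `Q(P)` at a point induced by an eigenvector. -/
theorem hessian_localExpr (hG : G.Connected) (hle : P ≤ G) {η : ℕ} {μ : ℝ} {f : V → ℝ}
    (hf : IsGroundState P (cutPotential G P q α) (fun _ => μ) f)
    (hind : ∀ e, α e = f e.1.2 / f e.1.1)
    (φ : SliceChart (equipartitionSet G P q) η α)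
    (hcrit : fderiv ℝ (φ.localExpr (equipartitionEnergy G P q)) φ.base = 0) (w : Fin η → ℝ) :
    ∃ u, shifted P (cutPotential G P q α) μ u = jumpAdjoint α (scaledTangent φ f w) ∧
      hessian (φ.localExpr (equipartitionEnergy G P q)) φ.base w w * ∑ v, f v ^ 2 =
        2 * (∑ e, scaledTangent φ f w e ^ 2 / -α e -
          dotProduct u (jumpAdjoint α (scaledTangent φ f w))) := by
  have hα0 := φ.mem_set.1
  set F := φ.localExpr (equipartitionEnergy G P q) with hF
  obtain ⟨Ψ, hΨs, hΨ0, -, hΨ⟩ := hf.exists_contDiffAt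
  have hpot : ContDiffAt ℝ ∞ (fun t => cutPotential G P q (φ.param t)) φ.base := by
    refine ContDiffAt.comp φ.base (g := cutPotential G P q) ?_ φ.contDiffAt_param
    rw [φ.param_base]
    exact contDiffAt_cutPotential G P q hα0
  set ψ : (Fin η → ℝ) → V → ℝ := fun t => Ψ (cutPotential G P q (φ.param t)) with hψ
  have hψs : ContDiffAt ℝ ∞ ψ φ.base := by
    refine ContDiffAt.comp φ.base (g := Ψ) ?_ hpot
    rw [φ.param_base]
    exact hΨs
  have hψ0 : ψ φ.base = f := by simp only [hψ, φ.param_base, hΨ0]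
  have hgs : ∀ᶠ t in 𝓝 φ.base,
      IsGroundState P (cutPotential G P q (φ.param t)) (fun _ => F t) (ψ t) := by
    have h1 : ∀ᶠ t in 𝓝 φ.base, ∀ k, F t = domainEnergy G P q (φ.param t) k :=
      Filter.eventually_all.2 fun k => eventually_localExpr_eq φ k
    have h2 := hpot.continuousAt.eventually (p := fun x => IsGroundState P x (energy P x) (Ψ x))
      (by beta_reduce; rw [φ.param_base]; exact hΨ)
    filter_upwards [h1, h2] with t ht1 ht2
    rw [← domainEnergy_eq hle] at ht2
    convert ht2 using 1
    exact funext ht1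
  have hF0 : F φ.base = μ := by
    obtain ⟨v₀⟩ := hG.nonempty
    have h1 : F φ.base = domainEnergy G P q (φ.param φ.base) (P.connectedComponentMk v₀) :=
      (eventually_localExpr_eq φ (P.connectedComponentMk v₀)).self_of_nhds
    rw [h1, φ.param_base, domainEnergy_eq hle, hf.energy_eq]
  obtain ⟨hF1, hF2⟩ := hasDerivAt_along_line (contDiffAt_localExpr hG hle φ) w
  obtain ⟨ha1, ha2⟩ := hasDerivAt_along_line φ.contDiffAt_param w
  obtain ⟨hψ1, -⟩ := hasDerivAt_along_line hψs w
  have htend : Filter.Tendsto (fun t : ℝ => φ.base + t • w) (𝓝 0) (𝓝 φ.base) := by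
    have : Continuous fun t : ℝ => φ.base + t • w := by fun_prop
    simpa using this.tendsto 0
  have hgs' := (htend.eventually hgs).eventually_nhds
  have hne : ∀ᶠ s in 𝓝 (0 : ℝ), ∀ e, φ.param (φ.base + s • w) e ≠ 0 := by
    filter_upwards [htend.eventually φ.eventually_param_mem] with s hs using hs.1

  -- Hellmann–Feynman at all nearby points of the line, so that both sides may be differentiated at
  -- `0`.
  have hHF : ∀ᶠ s in 𝓝 (0 : ℝ),
      ∑ e : CutEdge G P, fderiv ℝ φ.param (φ.base + s • w) w e *
        (ψ (φ.base + s • w) e.1.2 ^ 2 / φ.param (φ.base + s • w) e ^ 2 -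
          ψ (φ.base + s • w) e.1.1 ^ 2) =
      fderiv ℝ F (φ.base + s • w) w * ∑ v, ψ (φ.base + s • w) v ^ 2 := by
    filter_upwards [hF1, ha1, hψ1, hgs', hne] with s h1 h2 h3 h4 h5
    have h6 := hellmann_feynman h4
      (hasDerivAt_cutPotential G P q (hasDerivAt_pi.1 h2) h5) (hasDerivAt_pi.1 h3)
      (fun _ => h1) fun _ => 1
    rw [← sum_mul_cutPotentialDeriv G P (φ.param (φ.base + s • w))
      (fderiv ℝ φ.param (φ.base + s • w) w) fun v => ψ (φ.base + s • w) v ^ 2]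
    simp only [one_mul] at h6
    rw [h6, ← Finset.sum_mul, mul_comm]
  set β := fderiv ℝ φ.param φ.base w with hβ
  set u := fderiv ℝ ψ φ.base w with hu
  have h00 : φ.base + (0 : ℝ) • w = φ.base := by simp
  have ha0 := ha1.self_of_nhds
  have hψ0' := hψ1.self_of_nhds
  have hF0' := hF1.self_of_nhds
  rw [h00, hcrit] at hF0'
  rw [h00] at ha0 hψ0'
  have hf2 : ∀ e : CutEdge G P, f e.1.2 = α e * f e.1.1 := fun e => by
    rw [hind, div_mul_cancel₀ _ (hf.ne_zero _)]
  have hx : ∀ e, scaledTangent φ f w e = f e.1.1 * β e := fun e => rfl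
  -- The derivative of the ground state is the required solution: at a critical point the energy
  -- term drops out of the linearized equation.
  refine ⟨u, ?_, ?_⟩
  · ext v
    have h1 := hamiltonian_mulVec_deriv hgs'.self_of_nhds
      (hasDerivAt_cutPotential G P q (hasDerivAt_pi.1 ha0)
        (by rw [h00, φ.param_base]; exact hα0))
      (hasDerivAt_pi.1 hψ0') (E' := fun _ => 0) (fun _ => hF0') v
    rw [h00, φ.param_base, hF0, hψ0] at h1
    rw [shifted_apply, Pi.sub_apply, Pi.smul_apply, smul_eq_mul, h1]
    simp only [cutPotentialDeriv, jumpAdjoint, LinearMap.coe_mk, AddHom.coe_mk, hx]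
    rw [zero_sub, neg_neg, add_sub_cancel_left, Finset.sum_mul]
    refine Finset.sum_congr rfl fun e _ => ?_
    have hae := hα0 e
    have hfe := hf2 e
    by_cases h1 : e.1.1 = v <;> by_cases h2 : e.1.2 = v
    · exact absurd (h1.trans h2.symm) e.2.1.ne
    · simp only [h1, h2, if_true, if_false]; ring
    · rw [h2] at hfe
      simp only [h1, h2, if_true, if_false, hfe]
      field_simp
      ring
    · simp only [h1, h2, if_false]; ring
  · have hψv := hasDerivAt_pi.1 hψ0'
    have hav := hasDerivAt_pi.1 ha0
    have ha2v := hasDerivAt_pi.1 ha2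
    have hL : HasDerivAt (fun s : ℝ =>
        ∑ e : CutEdge G P, fderiv ℝ φ.param (φ.base + s • w) w e *
        (ψ (φ.base + s • w) e.1.2 ^ 2 / φ.param (φ.base + s • w) e ^ 2 -
          ψ (φ.base + s • w) e.1.1 ^ 2))
        (∑ e, 2 * (scaledTangent φ f w e ^ 2 / -α e -
          jump α u e * scaledTangent φ f w e)) 0 := by
      refine HasDerivAt.fun_sum fun e _ => ?_
      have hb := (((hψv e.1.2).fun_pow 2).fun_div ((hav e).fun_pow 2)
        (pow_ne_zero 2 (by rw [h00, φ.param_base]; exact hα0 e))).fun_sub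
          ((hψv e.1.1).fun_pow 2)
      refine ((ha2v e).fun_mul hb).congr_deriv ?_
      simp only [h00, φ.param_base, hψ0, hx, jump_apply, hf2, ← hβ, ← hu]
      have hae := hα0 e
      field_simp
      ring
    have hR : HasDerivAt (fun s : ℝ =>
        fderiv ℝ F (φ.base + s • w) w * ∑ v, ψ (φ.base + s • w) v ^ 2)
        (hessian F φ.base w w * ∑ v, f v ^ 2) 0 := by
      -- The derivative of the norm does not contribute, because it is multiplied by the first
      -- derivative of the energy, which is zero.
      have hN : HasDerivAt (fun s : ℝ => ∑ v, ψ (φ.base + s • w) v ^ 2)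
          (∑ v, 2 * f v * u v) 0 := by
        refine HasDerivAt.fun_sum fun v _ => ?_
        refine ((hψv v).fun_pow 2).congr_deriv ?_
        simp [hψ0, hu]
      refine (hF2.fun_mul hN).congr_deriv ?_
      rw [h00, hcrit, hψ0]
      simp [hessian, hF]
    rw [hR.unique (hL.congr_of_eventuallyEq (hHF.mono fun s hs => hs.symm)),
      ← Finset.mul_sum, Finset.sum_sub_distrib]
    congr 2
    exact (sum_mul_jumpAdjoint u _).symm

end Hessian
end NodalMorse

namespace NodalMorse

/-! ### The Morse index at a point induced by an eigenvector -/

section MorseIndex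

variable {V : Type*} [Fintype V] [LinearOrder V] {G P : SimpleGraph V} {q : V → ℝ}
  {α : CutEdge G P → ℝ}

theorem shifted_symm {V : Type*} [Fintype V] (P : SimpleGraph V) (d : V → ℝ) (μ : ℝ)
    (u w : V → ℝ) : dotProduct u (shifted P d μ w) = dotProduct (shifted P d μ u) w := by
  have h := dotProduct_hamiltonian_comm P d w u
  rw [shifted_apply, shifted_apply, dotProduct_sub, sub_dotProduct, dotProduct_smul,
    smul_dotProduct, dotProduct_comm ((hamiltonian P d).mulVec u)]
  exact congrArg (· - _) h

theorem IsGroundState.shifted_nonneg {V : Type*} [Fintype V] {P : SimpleGraph V} {d : V → ℝ}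
    {μ : ℝ} {f : V → ℝ} (hf : IsGroundState P d (fun _ => μ) f) (u : V → ℝ) :
    0 ≤ dotProduct u (shifted P d μ u) :=
  hf.quadratic_nonneg u

theorem IsGroundState.shifted_rescale {V : Type*} [Fintype V] {P : SimpleGraph V} {d : V → ℝ}
    {μ : ℝ} {f : V → ℝ} (hf : IsGroundState P d (fun _ => μ) f) (c : P.ConnectedComponent → ℝ) :
    shifted P d μ (fun v => c (P.connectedComponentMk v) * f v) = 0 := by
  ext v
  have e := hf.eigen v
  rw [hamiltonian_mulVec_apply] at e
  rw [shifted_apply, Pi.sub_apply, hamiltonian_mulVec_apply]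
  have h1 : ∑ w, adjWeight P v w * (c (P.connectedComponentMk w) * f w) =
      c (P.connectedComponentMk v) * ∑ w, adjWeight P v w * f w := by
    rw [Finset.mul_sum]
    refine Finset.sum_congr rfl fun w _ => ?_
    rw [mul_left_comm (c _)]
    exact adjWeight_mul_congr P fun h => by rw [connectedComponentMk_eq_of_adj h]
  rw [h1]
  simp only [Pi.smul_apply, smul_eq_mul, Pi.zero_apply]
  linear_combination c (P.connectedComponentMk v) * e

/-- Simplicity of the energy on each domain: the restrictions of `f` to the domains form a basis of
the kernel. -/
theorem IsGroundState.finrank_ker_shifted {V : Type*} [Fintype V] {P : SimpleGraph V}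
    {d : V → ℝ} {μ : ℝ} {f : V → ℝ} (hf : IsGroundState P d (fun _ => μ) f) :
    Module.finrank ℝ (LinearMap.ker (shifted P d μ)) = numDomains P := by
  let L : (P.ConnectedComponent → ℝ) →ₗ[ℝ] (V → ℝ) :=
    { toFun := fun c v => c (P.connectedComponentMk v) * f v
      map_add' := fun a b => by ext v; simp [add_mul]
      map_smul' := fun a b => by ext v; simp [mul_assoc] }
  have hL : Function.Injective L := by
    rw [injective_iff_map_eq_zero]
    intro c hc
    ext k
    have := congrFun hc (domainRep k)
    simpa [L, hf.ne_zero] using this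
  have hrange : LinearMap.range L = LinearMap.ker (shifted P d μ) := by
    refine le_antisymm ?_ fun u hu => ?_
    · rintro _ ⟨c, rfl⟩
      exact hf.shifted_rescale c
    · obtain ⟨c, hc⟩ := hf.exists_eq_mul (g := u) fun v => by
        have := congrFun (LinearMap.mem_ker.1 hu) v
        rw [shifted_apply, Pi.sub_apply, Pi.zero_apply, sub_eq_zero] at this
        exact this
      exact ⟨c, funext fun v => (hc v).symm⟩
  rw [← hrange, LinearMap.finrank_range_of_inj hL, numDomains, Nat.card_eq_fintype_card,
    Module.finrank_fintype_fun_eq_card]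

theorem shifted_cutPotential (hle : P ≤ G) (hα : ∀ e, α e ≠ 0) (μ : ℝ) (u : V → ℝ) :
    shifted P (cutPotential G P q α) μ u =
      shifted G q μ u + jumpAdjoint α (fun e => -α e * jump α u e) := by
  ext v
  rw [shifted_apply, shifted_apply, Pi.sub_apply, Pi.add_apply, Pi.sub_apply,
    hamiltonian_cutPotential_mulVec hle hα]
  ring

/-- The scaled tangent vectors are those for which the linearized equation is solvable. -/
theorem exists_scaledTangent_eq (hG : G.Connected) (hle : P ≤ G) {η : ℕ}
    (hη : (η : ℤ) = numCutEdges G P - ((numDomains P : ℤ) - 1)) {μ : ℝ} {f : V → ℝ}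
    (hf : IsGroundState P (cutPotential G P q α) (fun _ => μ) f)
    (hind : ∀ e, α e = f e.1.2 / f e.1.1)
    (φ : SliceChart (equipartitionSet G P q) η α) {x : CutEdge G P → ℝ} {u : V → ℝ}
    (hu : shifted P (cutPotential G P q α) μ u = jumpAdjoint α x) :
    ∃ w, scaledTangent φ f w = x := by
  have hα0 := φ.mem_set.1
  set β : CutEdge G P → ℝ := fun e => x e / f e.1.1 with hβ
  have hxβ : ∀ e, x e = f e.1.1 * β e := fun e => by
    simp only [hβ]; rw [mul_div_cancel₀ _ (hf.ne_zero _)]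
  set c := fderiv ℝ (domainEnergy G P q) α β with hc
  -- Solvability makes `Jᵀ x` orthogonal to the kernel of `K`, in particular to `c f`. Weighting by
  -- the derivative `c` itself turns Hellmann–Feynman into a vanishing sum of squares.
  have hzero : c = 0 := by
    have h1 := sum_mul_fderiv_domainEnergy hle hα0 hf β c
    have h2 : ∑ e : CutEdge G P, β e * (c (P.connectedComponentMk e.1.2) * f e.1.2 ^ 2 / α e ^ 2 -
        c (P.connectedComponentMk e.1.1) * f e.1.1 ^ 2) =
        -∑ e, jump α (fun v => c (P.connectedComponentMk v) * f v) e * x e := by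
      rw [← Finset.sum_neg_distrib]
      refine Finset.sum_congr rfl fun e _ => ?_
      have hf2 : f e.1.2 = α e * f e.1.1 := by rw [hind, div_mul_cancel₀ _ (hf.ne_zero _)]
      have := hα0 e
      rw [jump_apply, hxβ, hf2]
      field_simp
      ring
    have h3 : ∑ e, jump α (fun v => c (P.connectedComponentMk v) * f v) e * x e = 0 := by
      rw [← sum_mul_jumpAdjoint, ← hu]
      have := shifted_symm P (cutPotential G P q α) μ
        (fun v => c (P.connectedComponentMk v) * f v) u
      rw [hf.shifted_rescale, zero_dotProduct] at this
      exact this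
    rw [h2, h3, neg_zero] at h1
    ext k
    have h4 := (Finset.sum_eq_zero_iff_of_nonneg (fun v _ => by
      have : c (P.connectedComponentMk v) * f v ^ 2 * c (P.connectedComponentMk v) =
        (c (P.connectedComponentMk v) * f v) ^ 2 := by ring
      rw [← hc, this]; exact sq_nonneg _)).1 h1 (domainRep k) (Finset.mem_univ _)
    rw [← hc, connectedComponentMk_domainRep] at h4
    have := hf.ne_zero (domainRep k)
    simpa [this] using h4
  have hT : β ∈ tangentSpace G P q α := fun k l => by
    rw [← hc, hzero]; rfl
  rw [← range_fderiv_param hG hle hη φ] at hT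
  obtain ⟨w, hw⟩ := hT
  refine ⟨w, funext fun e => ?_⟩
  rw [hxβ, ← hw]
  rfl

theorem scaledTangent_injective {η : ℕ} {f : V → ℝ} (hf : ∀ v, f v ≠ 0)
    (φ : SliceChart (equipartitionSet G P q) η α) : Function.Injective (scaledTangent φ f) := by
  rw [injective_iff_map_eq_zero]
  intro w hw
  refine (injective_iff_map_eq_zero _).1 φ.injective_fderiv_param w (funext fun e => ?_)
  exact (mul_eq_zero.1 (congrFun hw e)).resolve_left (hf _)

/-- The Morse index of the energy at a point induced by a nondegenerate eigenvector. -/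
theorem exists_hasMorseIndexOn (hG : G.Connected) (hle : P ≤ G) {η : ℕ}
    (hη : (η : ℤ) = numCutEdges G P - ((numDomains P : ℤ) - 1)) (hα : ∀ e, α e < 0)
    {μ : ℝ} {f : V → ℝ} (hf : IsNowhereZeroEigenvector G q μ f) (hP : nodalGraph G f = P)
    (hind : ∀ e, α e = f e.1.2 / f e.1.1)
    (hsimple : Module.finrank ℝ (eigenspaceOf G q μ) ≤ 1) {i : Fin (Fintype.card V)}
    (hi : sortedEigenvalue (hamiltonian_isHermitian G q) i = μ) :
    ∃ m : ℕ, HasMorseIndexOn (equipartitionSet G P q) η (equipartitionEnergy G P q) α m ∧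
      (m : ℤ) = ((i : ℕ) + 1 : ℤ) - numDomains P := by
  classical
  have hα0 : ∀ e, α e ≠ 0 := fun e => (hα e).ne
  have hcrit := isCriticalPointOn_of_eigenvector hG hle hη hf hP hind
  have hgs := hf.isGroundState hle hP hind
  set K := shifted P (cutPotential G P q α) μ with hK
  set N := shifted G q μ with hN
  have hJ : ∀ u x, dotProduct u (jumpAdjoint α x) = dotProduct (jump α u) x :=
    sum_mul_jumpAdjoint
  have ha : ∀ e, 0 < -α e := fun e => neg_pos.2 (hα e)
  have hKN := shifted_cutPotential (q := q) hle hα0 μ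
  have hKsymm := shifted_symm P (cutPotential G P q α) μ
  have hker := hgs.finrank_ker_shifted
  have hKf : K f = 0 := by
    have := hgs.shifted_rescale fun _ => 1
    simpa only [one_mul] using this
  have hJf : jump α f = 0 := by
    ext e
    have h1 := hf.2 e.1.1
    have h2 := hf.2 e.1.2
    rw [jump_apply, hind]
    field_simp
    simp
  obtain ⟨hcneg, hcpos⟩ := card_eigenvalues_lt (hamiltonian_isHermitian G q) hsimple hi
  obtain ⟨Eneg, hEneg, hneg⟩ := exists_spectral_subspace (hamiltonian_isHermitian G q) μ
    fun j => (hamiltonian_isHermitian G q).eigenvalues j < μ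
  obtain ⟨Epos, hEpos, hpos⟩ := exists_spectral_subspace (hamiltonian_isHermitian G q) μ
    fun j => μ < (hamiltonian_isHermitian G q).eigenvalues j
  have hneg' : ∀ v ∈ Eneg, v ≠ 0 → dotProduct v (N v) < 0 := by
    intro v hv hv0
    obtain ⟨c, hc, h⟩ := hneg v hv hv0
    obtain ⟨j, hj⟩ := Function.ne_iff.1 hc
    rw [hN, shifted_apply, h]
    refine Finset.sum_neg' (fun j _ => mul_nonpos_of_nonneg_of_nonpos (sq_nonneg _)
      (sub_nonpos.2 j.2.le)) ⟨j, Finset.mem_univ _, ?_⟩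
    exact mul_neg_of_pos_of_neg (sq_pos_iff.2 hj) (sub_neg.2 j.2)
  have hpos' : ∀ v ∈ Epos, v ≠ 0 → 0 < dotProduct v (N v) := by
    intro v hv hv0
    obtain ⟨c, hc, h⟩ := hpos v hv hv0
    obtain ⟨j, hj⟩ := Function.ne_iff.1 hc
    rw [hN, shifted_apply, h]
    refine Finset.sum_pos' (fun j _ => mul_nonneg (sq_nonneg _) (sub_nonneg.2 j.2.le))
      ⟨j, Finset.mem_univ _, ?_⟩
    exact mul_pos (sq_pos_iff.2 hj) (sub_pos.2 j.2)
  -- The space `Epos` has dimension `card V - (i + 1)`, which leaves `i + 1` for `W` and the kernel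
  -- of `K`.
  have hupper : ∀ W : Submodule ℝ (CutEdge G P → ℝ), (∀ x ∈ W, x ≠ 0 → ∃ u,
      K u = jumpAdjoint α x ∧ ∑ e, x e ^ 2 / -α e < dotProduct u (jumpAdjoint α x)) →
      Module.finrank ℝ W + numDomains P ≤ i + 1 := by
    intro W hW
    have := finrank_negative_subspace_le hJ ha hKN hpos' hKsymm hW
    rw [hker, hEpos, hcpos] at this
    have := i.2
    omega
  -- The bound for `W = ⊥`; it ensures that the natural number subtraction in the index below is not
  -- truncated.
  have hνi : numDomains P ≤ i + 1 := by
    have := hupper ⊥ fun x hx hx0 => absurd ((Submodule.mem_bot ℝ).1 hx) hx0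
    simpa using this
  obtain ⟨v₀⟩ := hG.nonempty
  have hfsum : 0 < ∑ v, f v ^ 2 :=
    Finset.sum_pos' (fun v _ => sq_nonneg _) ⟨v₀, Finset.mem_univ _, sq_pos_iff.2 (hf.2 v₀)⟩
  refine ⟨i + 1 - numDomains P, ⟨hcrit, fun φ => ⟨contDiffAt_localExpr hG hle φ, ?_, ?_⟩⟩,
    by omega⟩
  all_goals
    have hX := scaledTangent_injective hf.2 φ
    have hhess := fun w => hessian_localExpr hG hle hgs hind φ (hcrit.2 φ).fderiv w
  · obtain ⟨W, hWdim, hW⟩ := exists_negative_subspace hJ ha hKN hKsymm hgs.shifted_nonneg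
      (fun h => hf.2 v₀ (congrFun h v₀)) hKf hJf hneg'
    have hWX : (W.comap (scaledTangent φ f)).map (scaledTangent φ f) = W := by
      rw [Submodule.map_comap_eq, inf_eq_right]
      intro x hx
      by_cases hx0 : x = 0
      · exact ⟨0, by rw [map_zero, hx0]⟩
      · obtain ⟨u, hu, -⟩ := hW x hx hx0
        exact exists_scaledTangent_eq hG hle hη hgs hind φ hu
    refine ⟨W.comap (scaledTangent φ f), ?_, fun w hw hw0 => ?_⟩
    · have h1 := hupper W hW
      have h2 := finrank_map_of_forall (scaledTangent φ f) (W.comap (scaledTangent φ f))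
        fun w _ h => (injective_iff_map_eq_zero _).1 hX w h
      rw [hWX] at h2
      rw [hker, hEneg, hcneg] at hWdim
      omega
    · obtain ⟨u, hu, hlt⟩ := hW _ hw fun h => hw0 ((injective_iff_map_eq_zero _).1 hX w h)
      obtain ⟨u', hu', heq⟩ := hhess w
      -- Two solutions differ by an element of the kernel of `K`, and by symmetry the pairing does
      -- not see it.
      have h1 : dotProduct u' (jumpAdjoint α (scaledTangent φ f w)) =
          dotProduct u (jumpAdjoint α (scaledTangent φ f w)) := by
        nth_rewrite 1 [← hu]
        rw [hKsymm, hu', dotProduct_comm]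
      rw [h1] at heq
      nlinarith
  · rintro k ⟨W, rfl, hW⟩
    have h1 := hupper (W.map (scaledTangent φ f)) (by
      rintro _ ⟨w, hw, rfl⟩ hx
      obtain ⟨u, hu, heq⟩ := hhess w
      refine ⟨u, hu, ?_⟩
      have := hW w hw fun h => hx (by rw [h, map_zero])
      have := mul_neg_of_neg_of_pos this hfsum
      linarith)
    rw [finrank_map_of_forall _ W fun w _ h => (injective_iff_map_eq_zero _).1 hX w h] at h1
    omega

end MorseIndex

theorem nodalGraph_smul {V : Type*} (G : SimpleGraph V) {c : ℝ} (hc : c ≠ 0) (f : V → ℝ) :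
    nodalGraph G (c • f) = nodalGraph G f := by
  ext v w
  have h : (c • f) v * (c • f) w = c ^ 2 * (f v * f w) := by
    simp only [Pi.smul_apply, smul_eq_mul]; ring
  simp only [nodalGraph, h]
  rw [mul_pos_iff_of_pos_left (by positivity)]

end NodalMorse

theorem theorem4 {V : Type*} [Fintype V] [LinearOrder V]
    (G : SimpleGraph V) (hG : G.Connected) (q : V → ℝ)
    (P : SimpleGraph V) (hP : NodalMorse.IsPartition G P)
    (hbip : (NodalMorse.partitionGraph G P).IsBipartite)
    (η : ℕ)
    (hη : (η : ℤ) = NodalMorse.numCutEdges G P - ((NodalMorse.numDomains P : ℤ) - 1))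
    (hη_pos : 0 < η) :
    -- near any equipartition, `Q(P)` is a smooth submanifold of dimension `η`
    (∀ α ∈ NodalMorse.equipartitionSet G P q,
      NodalMorse.IsSmoothSubmanifoldAt (NodalMorse.equipartitionSet G P q) η α) ∧
    (∀ α : NodalMorse.CutEdge G P → ℝ, (∀ e, α e < 0) →
      -- critical points are the points induced by nowhere vanishing eigenvectors
      (NodalMorse.IsCriticalPointOn (NodalMorse.equipartitionSet G P q) η
          (NodalMorse.equipartitionEnergy G P q) α ↔
        ∃ f : V → ℝ,
          NodalMorse.IsNowhereZeroEigenvector G q (NodalMorse.equipartitionEnergy G P q α) f ∧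
          NodalMorse.nodalGraph G f = P ∧ α = NodalMorse.inducedParameters G P f) ∧
      -- if the energy is not a multiple eigenvalue of `H(G)`:
      (Module.finrank ℝ
          (NodalMorse.eigenspaceOf G q (NodalMorse.equipartitionEnergy G P q α)) ≤ 1 →
        -- critical points are the points induced by non-degenerate eigenvectors
        (NodalMorse.IsCriticalPointOn (NodalMorse.equipartitionSet G P q) η
            (NodalMorse.equipartitionEnergy G P q) α ↔
          ∃ f : V → ℝ,
            NodalMorse.IsNondegenerateEigenvector G q
              (NodalMorse.equipartitionEnergy G P q α) f ∧
            NodalMorse.nodalGraph G f = P ∧ α = NodalMorse.inducedParameters G P f) ∧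
        -- at a critical point, the Morse index is the nodal deficiency `n - ν_n`, `n = i + 1`
        (NodalMorse.IsCriticalPointOn (NodalMorse.equipartitionSet G P q) η
            (NodalMorse.equipartitionEnergy G P q) α →
          ∀ i : Fin (Fintype.card V),
            NodalMorse.sortedEigenvalue (NodalMorse.hamiltonian_isHermitian G q) i =
              NodalMorse.equipartitionEnergy G P q α →
            ∀ f : V → ℝ,
              Module.End.HasEigenvector (NodalMorse.hamiltonian G q).mulVecLin
                (NodalMorse.equipartitionEnergy G P q α) f →
              ∃ m : ℕ,
                NodalMorse.HasMorseIndexOn (NodalMorse.equipartitionSet G P q) η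
                  (NodalMorse.equipartitionEnergy G P q) α m ∧
                (m : ℤ) = ((i : ℕ) + 1 : ℤ) - NodalMorse.nodalCount G f))) := by
  have hle := hP.le
  refine ⟨fun α hα => NodalMorse.isSmoothSubmanifoldAt_equipartitionSet hG hle hη hα,
    fun α hα => ?_⟩
  have hforward := NodalMorse.exists_eigenvector_of_isCriticalPointOn (q := q) hG hP hbip hη hα
  refine ⟨⟨hforward, ?_⟩, fun hsimple => ⟨⟨fun hcrit => ?_, ?_⟩, fun hcrit i hi f hf => ?_⟩⟩
  · rintro ⟨f, hf, hfP, hind⟩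
    exact NodalMorse.isCriticalPointOn_of_eigenvector hG hle hη hf hfP fun e => congrFun hind e
  · obtain ⟨f, hf, hfP, hind⟩ := hforward hcrit
    refine ⟨f, ⟨hf, le_antisymm hsimple ?_⟩, hfP, hind⟩
    exact Module.finrank_pos_iff_exists_ne_zero.2
      ⟨⟨f, hf.1.1⟩, fun h => hf.1.2 (congrArg Subtype.val h)⟩
  · rintro ⟨f, ⟨hf, -⟩, hfP, hind⟩
    exact NodalMorse.isCriticalPointOn_of_eigenvector hG hle hη hf hfP fun e => congrFun hind e
  · obtain ⟨g, hg, hgP, hind⟩ := hforward hcrit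
    -- The eigenspace is a line, so the given `f` is proportional to the eigenvector `g` that
    -- induces `P` and has the same nodal domains.
    have hcount : NodalMorse.nodalCount G f = NodalMorse.numDomains P := by
      obtain ⟨v, hv⟩ := finrank_le_one_iff.1 hsimple
      obtain ⟨c, hc⟩ := hv ⟨f, hf.1⟩
      obtain ⟨c', hc'⟩ := hv ⟨g, hg.1.1⟩
      have h1 : c • (v : V → ℝ) = f := congrArg Subtype.val hc
      have h2 : c' • (v : V → ℝ) = g := congrArg Subtype.val hc'
      have hc0 : c ≠ 0 := by
        rintro rfl
        exact hf.2 (by rw [← h1, zero_smul])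
      have hc0' : c' ≠ 0 := by
        rintro rfl
        exact hg.1.2 (by rw [← h2, zero_smul])
      rw [NodalMorse.nodalCount, ← h1, NodalMorse.nodalGraph_smul G hc0,
        ← NodalMorse.nodalGraph_smul G hc0', h2, hgP]
    rw [hcount]
    exact NodalMorse.exists_hasMorseIndexOn hG hle hη hα hg hgP (fun e => congrFun hind e)
      hsimple hi
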